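/- **Theorem (Joint Hölder continuity).** Let $X$ be a set with a generalized metric $d$ (a metric that may take the value $\infty$) and a $\sigma$-finite measure $\mu$. For $\alpha\in(0,1]$ let $C^{0,\alpha}(X)$ be the space of bounded functions $g:X\to\mathbb{C}$ with finite norm $\|g\|_\infty+\sup_{x\ne x'}|g(x)-g(x')|/d(x,x')^\alpha$, and let $C^{0,\alpha}(X\times X)$ be defined in the same way with the metric $d(x,x')+d(y,y')$ on $X\times X$. Let $r\in(1,\infty)$, $r'=r/(r-1)$, $L^r(X)=L^r(X,\mu;\mathbb{C})$, and let a closed, densely defined linear operator $A$ on $L^r(X)$ generate a differentiable semigroup $(e^{tA})_{t\ge0}$ on $L^r(X)$, i.e. a strongly continuous semigroup all of whose orbits are differentiable on $(0,\infty)$. Let $A'$ be the adjoint of $A$ on $L^{r'}(X)$ with respect to the pairing $\langle f,g\rangle=\int_X fg\,d\mu$. Suppose that $D(A^k)\hookrightarrow C^{0,\alpha}(X)$ and $D((A')^l)\hookrightarrow C^{0,\alpha}(X)$ for some $k,l\in\mathbb{N}$ and some $\alpha\in(0,1]$; here domains carry the graph norm, and an embedding is a bounded linear map that assigns to each element one of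 its representatives. A *heat kernel* associated with $A$ is a function $p:(0,\infty)\times X\times X\to\mathbb{C}$ such that, for all $s,t>0$ and $f\in L^r(X)$: * $p_t$ is measurable with respect to the completed product measure, $p_t(x,\cdot)f\in L^1(X)$ for a.e. $x$, and $\int_X p_t(\cdot,y)f(y)\,d\mu(y)$ belongs to $L^r(X)$ and equals $e^{tA}f$; * for a.e. $y$, the map $t\mapsto p_t(\cdot,y)$ belongs to $C^1((0,\infty);L^r(X))\cap C((0,\infty);D(A))$ and $\partial_t p_t(\cdot,y)=A_xp_t(\cdot,y)$ for all $t>0$; * $p_{t+s}(x,y)=\int_X p_t(x,z)p_s(z,y)\,d\mu(z)$ for a.e. $(x,y)$, where the integral converges absolutely. Then $A$ is associated with a heat kernel $p$; for each $t>0$ it is unique up to $\mu\otimes\mu$-null sets, and it can be chosen such that the following holds (and, if the open sets of $X$ are measurable, such that every $p_t$ is measurable for the product $\sigma$-algebra itself). (i) $p_t\in C^{0,\alpha}(X\times X)$ for all $t>0$. (ii) If $r=2$ and $A=A'$ as operators on $L^2(X)$, then $A_xA_yp_t:X\times X\to\mathbb{C}$ is well defined and has a version in $C^{0,\alpha}(X\times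 X)$, for all $t>0$; here $A_x$ and $A_y$ denote the action of $A$ with respect to the first and the second coordinate. If $r=2$ and $A$ is self-adjoint in the Hilbert space sense instead, the same holds for $A_xA'_yp_t$ (in this case $A'g=\overline{A\bar g}$, so that $A'=A$ if $A$ commutes with complex conjugation). -/

import Mathlib

open MeasureTheory Filter Topology
open scoped ENNReal NNReal

noncomputable section

namespace HeatKernel

/-! ### Strongly continuous semigroups and unbounded operators -/

section Abstract

variable {E : Type*} [NormedAddCommGroup E] [NormedSpace ℂ E]

/-- `(T t)_{t ≥ 0}` is a strongly continuous semigroup on `E` (values at `t < 0` are irrelevant). -/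
structure IsC0Semigroup (T : ℝ → E →L[ℂ] E) : Prop where
  map_zero : T 0 = ContinuousLinearMap.id ℂ E
  map_add : ∀ s t : ℝ, 0 ≤ s → 0 ≤ t → T (s + t) = (T s).comp (T t)
  tendsto_zero : ∀ f : E, Tendsto (fun t => T t f) (𝓝[>] 0) (𝓝 f)

/-- `A` is the generator of `T`: `f ∈ D(A)` and `A f = g` iff `(T t f - f) / t → g` as `t ↓ 0`. -/
def IsGenerator (A : E →ₗ.[ℂ] E) (T : ℝ → E →L[ℂ] E) : Prop :=
  ∀ f g : E, (f, g) ∈ A.graph ↔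
    Tendsto (fun t : ℝ => ((t : ℂ)⁻¹) • (T t f - f)) (𝓝[>] 0) (𝓝 g)

/-- The semigroup is differentiable: all orbits are differentiable on `(0, ∞)`. -/
def IsDifferentiableSemigroup (T : ℝ → E →L[ℂ] E) : Prop :=
  ∀ f : E, ∀ t : ℝ, 0 < t →
    ∃ g : E, Tendsto (fun h : ℝ => ((h : ℂ)⁻¹) • (T (t + h) f - T t f)) (𝓝[≠] 0) (𝓝 g)

/-- The graph of the composition `A ∘ B`. -/
def compGraph (A B : E →ₗ.[ℂ] E) : Submodule ℂ (E × E) where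
  carrier := {fg | ∃ h, (fg.1, h) ∈ B.graph ∧ (h, fg.2) ∈ A.graph}
  add_mem' := fun {_ _} ⟨h, hB, hA⟩ ⟨h', hB', hA'⟩ =>
    ⟨h + h', B.graph.add_mem hB hB', A.graph.add_mem hA hA'⟩
  zero_mem' := ⟨0, B.graph.zero_mem, A.graph.zero_mem⟩
  smul_mem' := fun c _ ⟨h, hB, hA⟩ => ⟨c • h, B.graph.smul_mem c hB, A.graph.smul_mem c hA⟩

/-- The composition `A ∘ B` with `D(A ∘ B) = {f ∈ D(B) | B f ∈ D(A)}`. -/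
def opComp (A B : E →ₗ.[ℂ] E) : E →ₗ.[ℂ] E := (compGraph A B).toLinearPMap

theorem opComp_graph (A B : E →ₗ.[ℂ] E) : (opComp A B).graph = compGraph A B := by
  refine Submodule.toLinearPMap_graph_eq _ ?_
  rintro ⟨f, g⟩ ⟨h, hB, hA⟩ (rfl : f = 0)
  have h0 : h = 0 := B.graph_fst_eq_zero_snd hB rfl
  exact A.graph_fst_eq_zero_snd hA h0

/-- The powers `A ^ k`, with `A ^ 0` the identity on the whole space. -/
def opPow (A : E →ₗ.[ℂ] E) : ℕ → (E →ₗ.[ℂ] E)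
  | 0 => (LinearMap.id : E →ₗ[ℂ] E).toPMap ⊤
  | k + 1 => opComp A (opPow A k)

end Abstract

/-! ### Hölder continuous functions -/

section Holder

variable {X : Type*} [EMetricSpace X]

/-- The norm `‖g‖_∞ + |g|_{C^{0,α}}` of `C^{0,α}(X)`, with value `∞` outside that space. -/
def holderENorm (α : ℝ≥0) (g : X → ℂ) : ℝ≥0∞ :=
  (⨆ x, ‖g x‖ₑ) + eHolderNorm α g

/-- `q` belongs to `C^{0,α}(X × X)`: it is bounded and jointly `α`-Hölder continuous with respect
to the sum metric `d((x,y),(x',y')) = d(x,x') + d(y,y')`. -/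
def IsBoundedJointlyHolder (α : ℝ≥0) (q : X → X → ℂ) : Prop :=
  (∃ M : ℝ, ∀ x y, ‖q x y‖ ≤ M) ∧
    ∃ L : ℝ≥0, ∀ x y x' y',
      ‖q x y - q x' y'‖ₑ ≤ L * (edist x x' + edist y y') ^ (α : ℝ)

end Holder

/-! ### Operators on `L^r` -/

section Lp

variable {X : Type*} [MeasurableSpace X] {μ : Measure X}

/-- The dual pairing `⟨f, g⟩ = ∫ f g dμ` between `L^r` and `L^{r'}` (bilinear). -/
def pairing {r r' : ℝ≥0∞} [Fact (1 ≤ r)] [Fact (1 ≤ r')] [ENNReal.HolderConjugate r r'] :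
    Lp ℂ r μ →L[ℂ] Lp ℂ r' μ →L[ℂ] ℂ :=
  (ContinuousLinearMap.mul ℂ ℂ).lpPairing μ r r'

theorem pairing_eq_integral {r r' : ℝ≥0∞} [Fact (1 ≤ r)] [Fact (1 ≤ r')]
    [ENNReal.HolderConjugate r r'] (f : Lp ℂ r μ) (g : Lp ℂ r' μ) :
    pairing f g = ∫ x, f x * g x ∂μ := by
  simp [pairing, ContinuousLinearMap.lpPairing_eq_integral]

/-- The graph of the dual operator `A'` on `L^{r'}`:
all `(g, h)` with `⟨A f, g⟩ = ⟨f, h⟩` for every `f ∈ D(A)`. -/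
def dualGraph {r : ℝ≥0∞} (r' : ℝ≥0∞) [Fact (1 ≤ r)] [Fact (1 ≤ r')]
    [ENNReal.HolderConjugate r r'] (A : Lp ℂ r μ →ₗ.[ℂ] Lp ℂ r μ) :
    Submodule ℂ (Lp ℂ r' μ × Lp ℂ r' μ) where
  carrier := {gh | ∀ f : A.domain, pairing (A f) gh.1 = pairing (f : Lp ℂ r μ) gh.2}
  add_mem' := fun {a b} ha hb f => by
    rw [Prod.fst_add, Prod.snd_add, map_add, map_add, ha f, hb f]
  zero_mem' := fun f => by simp
  smul_mem' := fun c a ha f => by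
    rw [Prod.smul_fst, Prod.smul_snd, map_smul, map_smul, ha f]

/-- The dual (adjoint) operator `A'` on `L^{r'}` of a densely defined operator `A` on `L^r`. -/
def dualOp {r : ℝ≥0∞} (r' : ℝ≥0∞) [Fact (1 ≤ r)] [Fact (1 ≤ r')]
    [ENNReal.HolderConjugate r r'] (A : Lp ℂ r μ →ₗ.[ℂ] Lp ℂ r μ) :
    Lp ℂ r' μ →ₗ.[ℂ] Lp ℂ r' μ :=
  (dualGraph r' A).toLinearPMap

theorem pairing_right_injective [SigmaFinite μ] {r r' : ℝ≥0∞} [Fact (1 ≤ r)] [Fact (1 ≤ r')]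
    [ENNReal.HolderConjugate r r'] (hr : 1 < r) (h : Lp ℂ r' μ)
    (hh : ∀ f : Lp ℂ r μ, pairing f h = 0) : h = 0 := by
  have hr'top : r' ≠ ∞ := by
    have := (ENNReal.HolderConjugate.lt_top_iff_one_lt r' r).2 hr
    exact this.ne
  have hr'0 : r' ≠ 0 := (zero_lt_one.trans_le Fact.out).ne'
  rw [Lp.eq_zero_iff_ae_eq_zero]
  refine Lp.ae_eq_zero_of_forall_setIntegral_eq_zero h hr'0 hr'top ?_ ?_
  · intro s _ hs
    have : IsFiniteMeasure (μ.restrict s) := ⟨by simpa using hs⟩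
    exact ((Lp.memLp h).restrict s).integrable Fact.out
  · intro s hs hsμ
    have h1 := hh (indicatorConstLp r hs hsμ.ne (1 : ℂ))
    rw [pairing_eq_integral] at h1
    rw [← h1, ← integral_indicator hs]
    refine integral_congr_ae ?_
    filter_upwards [indicatorConstLp_coeFn (p := r) (hs := hs) (hμs := hsμ.ne) (c := (1 : ℂ))]
      with x hx
    rw [hx]
    by_cases hxs : x ∈ s <;> simp [hxs]

/-- For densely defined `A` the dual operator has the graph that defines it. -/
theorem dualOp_graph [SigmaFinite μ] {r r' : ℝ≥0∞} [Fact (1 ≤ r)] [Fact (1 ≤ r')]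
    [ENNReal.HolderConjugate r r'] (hr : 1 < r) (A : Lp ℂ r μ →ₗ.[ℂ] Lp ℂ r μ)
    (hA : Dense (A.domain : Set (Lp ℂ r μ))) :
    (dualOp r' A).graph = dualGraph r' A := by
  refine Submodule.toLinearPMap_graph_eq _ ?_
  rintro ⟨g, h⟩ hgh (rfl : g = 0)
  refine pairing_right_injective hr h fun f => ?_
  have hcl : IsClosed {f : Lp ℂ r μ | pairing f h = 0} :=
    isClosed_eq (pairing.flip h).continuous continuous_const
  refine hcl.closure_subset_iff.2 ?_ (hA f)
  intro f hf
  have := hgh ⟨f, hf⟩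
  simpa using this.symm

/-- `Acts A f g`: the class of the function `f` belongs to `D(A)`, and `A f = g` almost
everywhere. -/
def Acts {r : ℝ≥0∞} [Fact (1 ≤ r)] (A : Lp ℂ r μ →ₗ.[ℂ] Lp ℂ r μ) (f g : X → ℂ) : Prop :=
  ∃ F G : Lp ℂ r μ, (F, G) ∈ A.graph ∧ f =ᵐ[μ] F ∧ g =ᵐ[μ] G

/-- `A = B` as operators on classes of functions, i.e. same domain and same action. It is used
when the exponents `r` and `s` are equal without being syntactically the same. -/
def SameOperator {r s : ℝ≥0∞} [Fact (1 ≤ r)] [Fact (1 ≤ s)]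
    (A : Lp ℂ r μ →ₗ.[ℂ] Lp ℂ r μ) (B : Lp ℂ s μ →ₗ.[ℂ] Lp ℂ s μ) : Prop :=
  ∀ f g : X → ℂ, Acts A f g ↔ Acts B f g

/-- The continuous embedding `D(B) ↪ C^{0,α}(X)`, where `D(B)` carries the graph norm: a linear map
that picks for every `f ∈ D(B)` a representative in `C^{0,α}(X)` and that is bounded. -/
def EmbedsInHolder [EMetricSpace X] {r : ℝ≥0∞} [Fact (1 ≤ r)]
    (B : Lp ℂ r μ →ₗ.[ℂ] Lp ℂ r μ) (α : ℝ≥0) : Prop :=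
  ∃ (J : B.domain →ₗ[ℂ] (X → ℂ)) (C : ℝ≥0), ∀ f : B.domain,
    J f =ᵐ[μ] (f : Lp ℂ r μ) ∧
      holderENorm α (J f) ≤ C * ENNReal.ofReal (‖(f : Lp ℂ r μ)‖ + ‖B f‖)

/-- `p` is the heat kernel associated with the generator `A` of the semigroup `T` on `L^r`.
Measurability of `p t` refers to the completion of the product measure. -/
structure IsHeatKernel {r : ℝ≥0∞} [Fact (1 ≤ r)] (A : Lp ℂ r μ →ₗ.[ℂ] Lp ℂ r μ)
    (T : ℝ → Lp ℂ r μ →L[ℂ] Lp ℂ r μ) (p : ℝ → X → X → ℂ) : Prop where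
  measurable : ∀ t, 0 < t → AEStronglyMeasurable (Function.uncurry (p t)) (μ.prod μ)
  integrable : ∀ t, 0 < t → ∀ f : Lp ℂ r μ, ∀ᵐ x ∂μ, Integrable (fun y => p t x y * f y) μ
  memLp : ∀ t, 0 < t → ∀ f : Lp ℂ r μ, MemLp (fun x => ∫ y, p t x y * f y ∂μ) r μ
  /-- `T t` is the integral operator with kernel `p t`. -/
  semigroup_eq : ∀ t, 0 < t → ∀ f : Lp ℂ r μ, T t f =ᵐ[μ] fun x => ∫ y, p t x y * f y ∂μ
  /-- For a.e. `y`, the map `t ↦ p t · y` is in `C¹((0,∞); L^r) ∩ C((0,∞); D(A))` and solves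
  `∂ₜ p = A_x p`. -/
  cauchy : ∀ᵐ y ∂μ, ∃ u : ℝ → A.domain,
    (∀ t, 0 < t → (fun x => p t x y) =ᵐ[μ] (u t : Lp ℂ r μ)) ∧
    ContDiffOn ℝ 1 (fun t => (u t : Lp ℂ r μ)) (Set.Ioi 0) ∧
    ContinuousOn (fun t => ((u t : Lp ℂ r μ), A (u t))) (Set.Ioi 0) ∧
    ∀ t, 0 < t → HasDerivAt (fun t => (u t : Lp ℂ r μ)) (A (u t)) t
  chapman_kolmogorov : ∀ s t, 0 < s → 0 < t → ∀ᵐ z ∂(μ.prod μ),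
    Integrable (fun w => p t z.1 w * p s w z.2) μ ∧
      p (t + s) z.1 z.2 = ∫ w, p t z.1 w * p s w z.2 ∂μ

/-- `w` is a version of `A_x B_y q`: the operator `B` is applied to the functions `q(x, ·)`, and then
`A` is applied to the resulting functions of the first variable. -/
def IsMixedAction {r s : ℝ≥0∞} [Fact (1 ≤ r)] [Fact (1 ≤ s)]
    (A : Lp ℂ r μ →ₗ.[ℂ] Lp ℂ r μ) (B : Lp ℂ s μ →ₗ.[ℂ] Lp ℂ s μ) (q w : X → X → ℂ) : Prop :=
  ∃ v : X → X → ℂ,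
    AEStronglyMeasurable (Function.uncurry v) (μ.prod μ) ∧
    AEStronglyMeasurable (Function.uncurry w) (μ.prod μ) ∧
    (∀ x, Acts B (fun y => q x y) (fun y => v x y)) ∧
    (∀ y, Acts A (fun x => v x y) (fun x => w x y))

end Lp

end HeatKernel

end

/-! For t > 0 the operator T(t) maps L^r into D(A^k), so T(t) f has a representative in C^{0,α}, and
its value at x is a bounded functional of f. By Riesz representation a kernel x ↦ κ(x) ∈ L^{r'}
should arise, bounded and α-Hölder as a vector-valued map. The adjoint semigroup T' yields y ↦ κ'(y)
∈ L^r in the same way. For a small time τ < t/2, at which both kernels are taken, put p_t(x,y) =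
⟨T(t − 2τ) κ'(y), κ(x)⟩. A bounded bilinear form in two Hölder maps is jointly Hölder, which is (i).
Unbounded operators only meet the middle factor: with σ = t − 2τ and B = A T(σ/2), the function ⟨B²
κ'(y), κ(x)⟩ is A_x A'_y p_t and is Hölder for the same reason, which is (ii).

The first obstacle is measurability: X need not be separable and its open sets need not be
measurable, so continuity of κ does not make it strongly measurable.
`exists_countablyGenerated_factor` removes this. For a positive weight w ∈ L², the map formally
given by h ↦ S(w h), S = T(τ/2), sends L² boundedly into bounded functions. By Bessel's inequality
it is Hilbert–Schmidt into L² of a finite measure, hence it ignores all but countably many basis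
vectors. Together with w these vectors define a map to a countably generated space, whose L^{r'} is
separable. Pettis' theorem applies there, and `exists_isKernelOf` pulls the kernel back.

The second obstacle is that Hölder representatives may differ on null sets, so kernels at different
times are compatible only almost everywhere. Only the times 1/(n+1) are used, hence one null set
suffices (`ae_forall_orbit_eq`). This gives the Chapman–Kolmogorov identity and the Cauchy problem.
Uniqueness (`kernel_unique`) is a Fubini argument on rectangles. -/

noncomputable section

namespace HeatKernel

/-! ### Densities of functionals on L^r -/

section Riesz

variable {X : Type*} [MeasurableSpace X] {μ : Measure X} {r r' : ℝ≥0∞}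

/-- Dominated convergence in `L^r`. -/
theorem tendsto_Lp_of_dominated [Fact (1 ≤ r)] (hr_top : r ≠ ∞) {ι : Type*} {l : Filter ι}
    [l.IsCountablyGenerated] {F : ι → Lp ℂ r μ} {F₀ : Lp ℂ r μ} {G : X → ℝ}
    (hG : MemLp G r μ) (hb : ∀ i, ∀ᵐ x ∂μ, ‖F i x‖ ≤ G x)
    (h0 : ∀ᵐ x ∂μ, ‖F₀ x‖ ≤ G x)
    (hlim : ∀ᵐ x ∂μ, Tendsto (fun i => F i x) l (𝓝 (F₀ x))) : Tendsto F l (𝓝 F₀) := by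
  have hr0 : r ≠ 0 := (zero_lt_one.trans_le Fact.out).ne'
  have hrpos : 0 < r.toReal := ENNReal.toReal_pos hr0 hr_top
  rw [Lp.tendsto_Lp_iff_tendsto_eLpNorm']
  simp_rw [eLpNorm_eq_lintegral_rpow_enorm_toReal hr0 hr_top]
  have key : Tendsto (fun i => ∫⁻ x, ‖F i x - F₀ x‖ₑ ^ r.toReal ∂μ) l (𝓝 (∫⁻ _, 0 ∂μ)) := by
    refine tendsto_lintegral_filter_of_dominated_convergence
      (fun x => (2 * ‖G x‖ₑ) ^ r.toReal) (.of_forall fun i => ?_) (.of_forall fun i => ?_) ?_ ?_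
    · exact ((Lp.stronglyMeasurable (F i)).sub (Lp.stronglyMeasurable F₀)).enorm.pow_const _
    · filter_upwards [hb i, h0] with x h1 h2
      gcongr
      rw [two_mul]
      refine (enorm_sub_le (E := ℂ)).trans (add_le_add ?_ ?_)
      · exact enorm_le_iff_norm_le (F := ℝ) |>.2 (h1.trans (le_abs_self _))
      · exact enorm_le_iff_norm_le (F := ℝ) |>.2 (h2.trans (le_abs_self _))
    · have := (hG.const_mul 2).eLpNorm_lt_top
      rw [eLpNorm_lt_top_iff_lintegral_rpow_enorm_lt_top hr0 hr_top] at this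
      refine (lt_of_eq_of_lt ?_ this).ne
      refine lintegral_congr fun x => ?_
      rw [enorm_mul, Real.enorm_eq_ofReal zero_le_two]
      simp
    · filter_upwards [hlim] with x hx
      have h1 : Tendsto (fun i => ‖F i x - F₀ x‖ₑ) l (𝓝 0) := by
        have := (hx.sub_const (F₀ x)).enorm
        simpa using this
      have := h1.ennrpow_const r.toReal
      simpa [ENNReal.zero_rpow_of_pos hrpos] using this
  have := key.ennrpow_const (1 / r.toReal)
  simpa [hrpos] using this

theorem toLp_indicator_eq_zero {w : X → ℂ} (hw : MemLp w r μ) {E : Set X}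
    (hE : MeasurableSet E) (h0 : μ E = 0) : (hw.indicator hE).toLp _ = 0 :=
  (Lp.eq_zero_iff_ae_eq_zero).2 ((hw.indicator hE).coeFn_toLp.trans (indicator_meas_zero h0))

/-- Partial sums are indicators of finite unions times w, dominated by |w|. They converge in L^r
because r < ∞. This is the σ-additivity needed for Radon–Nikodym. -/
theorem hasSum_functional_indicator [Fact (1 ≤ r)] (hr_top : r ≠ ∞)
    (ψ : Lp ℂ r μ →L[ℝ] ℝ) {w : X → ℂ} (hw : MemLp w r μ) {f : ℕ → Set X}
    (hf : ∀ i, MeasurableSet (f i)) (hd : Pairwise (Function.onFun Disjoint f)) :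
    HasSum (fun i => ψ ((hw.indicator (hf i)).toLp _))
      (ψ ((hw.indicator (MeasurableSet.iUnion hf)).toLp _)) := by
  have hs : ∀ s : Finset ℕ, MeasurableSet (⋃ i ∈ s, f i) := fun s =>
    Finset.measurableSet_biUnion s fun i _ => hf i
  have hsum : ∀ s : Finset ℕ, ∑ i ∈ s, ψ ((hw.indicator (hf i)).toLp _)
      = ψ ((hw.indicator (hs s)).toLp _) := by
    intro s
    rw [← map_sum]
    congr 1
    apply Lp.ext
    refine (Lp.coeFn_fun_finsetSum _ _).trans ?_
    have h1 : ∀ᵐ x ∂μ, ∀ i, (hw.indicator (hf i)).toLp _ x = (f i).indicator w x :=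
      ae_all_iff.2 fun i => (hw.indicator (hf i)).coeFn_toLp
    filter_upwards [h1, (hw.indicator (hs s)).coeFn_toLp] with x h1 h2
    rw [h2, Finset.indicator_biUnion_apply]
    · exact Finset.sum_congr rfl fun i _ => h1 i
    · intro i _ j _ hij
      exact hd hij
  rw [HasSum, SummationFilter.unconditional_filter]
  simp_rw [hsum]
  refine (ψ.continuous.tendsto _).comp ?_
  have hle : ∀ {E : Set X} (hE : MeasurableSet E),
      ∀ᵐ x ∂μ, ‖(hw.indicator hE).toLp _ x‖ ≤ ‖w x‖ := fun hE => by
    filter_upwards [(hw.indicator hE).coeFn_toLp] with x hx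
    rw [hx]
    exact norm_indicator_le_norm_self _ _
  refine tendsto_Lp_of_dominated hr_top hw.norm (fun s => hle (hs s)) (hle (.iUnion hf)) ?_
  have h1 : ∀ᵐ x ∂μ, ∀ s : Finset ℕ,
      (hw.indicator (hs s)).toLp _ x = (⋃ i ∈ s, f i).indicator w x :=
    ae_all_iff.2 fun s => (hw.indicator (hs s)).coeFn_toLp
  filter_upwards [h1, (hw.indicator (MeasurableSet.iUnion hf)).coeFn_toLp] with x h1 h2
  simp_rw [h1, h2]
  exact (tendsto_indicator_biUnion_finset f w x).mono_right (pure_le_nhds _)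

/-- The set function `E ↦ ψ (1_E w)` of a continuous functional `ψ` on `L^r` has a density. -/
theorem exists_density_of_functional [SigmaFinite μ] [Fact (1 ≤ r)] (hr_top : r ≠ ∞)
    (ψ : Lp ℂ r μ →L[ℝ] ℝ) {w : X → ℂ} (hw : MemLp w r μ) :
    ∃ h : X → ℝ, Measurable h ∧ Integrable h μ ∧ ∀ (E : Set X) (hE : MeasurableSet E),
      ψ ((hw.indicator hE).toLp _) = ∫ x in E, h x ∂μ := by
  classical
  let c : SignedMeasure X :=
    { measureOf' := fun E => if hE : MeasurableSet E then ψ ((hw.indicator hE).toLp _) else 0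
      empty' := by
        rw [dif_pos MeasurableSet.empty, toLp_indicator_eq_zero hw .empty measure_empty,
            map_zero]
      not_measurable' := fun E hE => dif_neg hE
      m_iUnion' := fun f hf hd => by
        simp only [hf, MeasurableSet.iUnion hf, dif_pos]
        exact hasSum_functional_indicator hr_top ψ hw hf hd }
  have hc : ∀ (E : Set X) (hE : MeasurableSet E), c E = ψ ((hw.indicator hE).toLp _) :=
    fun E hE => dif_pos hE
  have hac : c ≪ᵥ μ.toENNRealVectorMeasure := by
    refine VectorMeasure.AbsolutelyContinuous.mk fun E hE h0 => ?_
    rw [Measure.toENNRealVectorMeasure_apply_measurable hE] at h0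
    rw [hc E hE, toLp_indicator_eq_zero hw hE h0, map_zero]
  refine ⟨c.rnDeriv μ, SignedMeasure.measurable_rnDeriv c μ,
    SignedMeasure.integrable_rnDeriv c μ, fun E hE => ?_⟩
  rw [← hc E hE, ← withDensityᵥ_apply (SignedMeasure.integrable_rnDeriv c μ) hE,
    SignedMeasure.withDensityᵥ_rnDeriv_eq c μ hac]

theorem exists_complex_density_of_functional [SigmaFinite μ] [Fact (1 ≤ r)] (hr_top : r ≠ ∞)
    (φ : Lp ℂ r μ →L[ℂ] ℂ) {w : X → ℂ} (hw : MemLp w r μ) :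
    ∃ h : X → ℂ, Measurable h ∧ Integrable h μ ∧ ∀ (E : Set X) (hE : MeasurableSet E),
      φ ((hw.indicator hE).toLp _) = ∫ x in E, h x ∂μ := by
  obtain ⟨a, ham, ha, ha'⟩ := exists_density_of_functional hr_top
    (Complex.reCLM.comp (φ.restrictScalars ℝ)) hw
  obtain ⟨b, hbm, hb, hb'⟩ := exists_density_of_functional hr_top
    (Complex.imCLM.comp (φ.restrictScalars ℝ)) hw
  have hab : Integrable (fun x => (a x : ℂ) + b x * Complex.I) μ :=
    ha.ofReal.add (hb.ofReal.mul_const _)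
  refine ⟨fun x => a x + b x * Complex.I, by fun_prop, hab, fun E hE => ?_⟩
  simp only
  rw [integral_add ha.ofReal.restrict (hb.ofReal.mul_const _).restrict,
    integral_mul_const, integral_complex_ofReal, integral_complex_ofReal, ← ha' E hE, ← hb' E hE]
  simp [Complex.re_add_im]

/-- The density of `E ↦ φ (1_E w)` represents `φ` on the multiples of `w` by bounded functions. -/
theorem functional_eq_integral_of_bounded [SigmaFinite μ] [Fact (1 ≤ r)] (hr_top : r ≠ ∞)
    (φ : Lp ℂ r μ →L[ℂ] ℂ) {w : X → ℂ} (hw : MemLp w r μ) {h : X → ℂ} (hh : Integrable h μ)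
    (hφ : ∀ (E : Set X) (hE : MeasurableSet E),
      φ ((hw.indicator hE).toLp _) = ∫ x in E, h x ∂μ)
    {b : X → ℂ} (hb : StronglyMeasurable b) {C : ℝ} (hC : ∀ x, ‖b x‖ ≤ C)
    {F : Lp ℂ r μ} (hF : F =ᵐ[μ] fun x => b x * w x) : φ F = ∫ x, b x * h x ∂μ := by
  classical
  have hsimple : ∀ s : SimpleFunc X ℂ, ∀ F : Lp ℂ r μ, F =ᵐ[μ] (fun x => s x * w x) →
      φ F = ∫ x, s x * h x ∂μ := by
    intro s
    induction s using SimpleFunc.induction with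
    | const c hs =>
      rename_i E
      intro F hF
      have : F = c • (hw.indicator hs).toLp _ := by
        apply Lp.ext
        filter_upwards [hF, Lp.coeFn_smul c ((hw.indicator hs).toLp _),
          (hw.indicator hs).coeFn_toLp] with x h1 h2 h3
        rw [h1, h2, Pi.smul_apply, h3]
        by_cases hx : x ∈ E <;> simp [hx]
      rw [this, map_smul, hφ E hs, ← integral_indicator hs, smul_eq_mul, ← integral_const_mul]
      refine integral_congr_ae (.of_forall fun x => ?_)
      by_cases hx : x ∈ E <;> simp [hx]
    | add hd hf hg =>
      rename_i f g
      intro F hF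
      have hm : ∀ f : SimpleFunc X ℂ, MemLp (fun x => f x * w x) r μ := fun f => by
        obtain ⟨C, hC⟩ := f.exists_forall_norm_le
        refine (hw.const_mul (C : ℂ)).of_le
          (f.aestronglyMeasurable.mul hw.1) (.of_forall fun x => ?_)
        rw [norm_mul, norm_mul]
        gcongr
        exact (hC x).trans ((le_abs_self C).trans (by simp))
      have hi : ∀ f : SimpleFunc X ℂ, Integrable (fun x => f x * h x) μ := fun f => by
        obtain ⟨C, hC⟩ := f.exists_forall_norm_le
        exact hh.bdd_mul f.aestronglyMeasurable (.of_forall hC)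
      have : F = (hm f).toLp _ + (hm g).toLp _ := by
        apply Lp.ext
        filter_upwards [hF, Lp.coeFn_add ((hm f).toLp _) ((hm g).toLp _), (hm f).coeFn_toLp,
          (hm g).coeFn_toLp] with x h1 h2 h3 h4
        rw [h1, h2, Pi.add_apply, h3, h4, SimpleFunc.coe_add, Pi.add_apply, add_mul]
      rw [this, map_add, hf _ (hm f).coeFn_toLp, hg _ (hm g).coeFn_toLp,
        ← integral_add (hi f) (hi g)]
      simp [add_mul]
  have hC0 : ∀ x : X, 0 ≤ C := fun x => (norm_nonneg _).trans (hC x)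
  have hC0' : 0 ≤ max C 0 := le_max_right _ _
  have hC' : ∀ x, ‖b x‖ ≤ max C 0 := fun x => (hC x).trans (le_max_left _ _)
  let s := hb.approxBounded (max C 0)
  have hsb : ∀ n x, ‖s n x‖ ≤ max C 0 := fun n x => hb.norm_approxBounded_le hC0' n x
  have hsl : ∀ x, Tendsto (fun n => s n x) atTop (𝓝 (b x)) := fun x =>
    hb.tendsto_approxBounded_of_norm_le (hC' x)
  have hG : MemLp (fun x => max C 0 * ‖w x‖) r μ := hw.norm.const_mul _
  have hle : ∀ n x, ‖s n x * w x‖ ≤ max C 0 * ‖w x‖ := fun n x => by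
    rw [norm_mul]
    gcongr
    exact hsb n x
  have hm : ∀ n, MemLp (fun x => s n x * w x) r μ := fun n =>
    hG.of_le ((s n).aestronglyMeasurable.mul hw.1)
      (.of_forall fun x => (hle n x).trans (le_abs_self _))
  have hT : Tendsto (fun n => (hm n).toLp _) atTop (𝓝 F) := by
    refine tendsto_Lp_of_dominated hr_top hG (fun n => ?_) ?_ ?_
    · filter_upwards [(hm n).coeFn_toLp] with x hx
      rw [hx]
      exact hle n x
    · filter_upwards [hF] with x hx
      rw [hx, norm_mul]
      gcongr
      exact hC' x
    · filter_upwards [hF, ae_all_iff.2 fun n => (hm n).coeFn_toLp] with x h1 h2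
      simp_rw [h1, h2]
      exact (hsl x).mul_const _
  have h1 : Tendsto (fun n => φ ((hm n).toLp _)) atTop (𝓝 (φ F)) := (φ.continuous.tendsto _).comp hT
  refine tendsto_nhds_unique h1 ?_
  simp_rw [fun n => hsimple (s n) _ (hm n).coeFn_toLp]
  refine tendsto_integral_of_dominated_convergence (fun x => max C 0 * ‖h x‖)
    (fun n => (s n).aestronglyMeasurable.mul hh.1) (hh.norm.const_mul _) (fun n => ?_) ?_
  · refine .of_forall fun x => ?_
    rw [norm_mul]
    gcongr
    exact hsb n x
  · exact .of_forall fun x => (hsl x).mul_const _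

end Riesz

/-! ### Riesz representation and adjoints -/

section Riesz

variable {X : Type*} [MeasurableSpace X] {μ : Measure X} {r r' : ℝ≥0∞}

/-- Root of a positive integrable function. The weight replaces the constant 1, which is not in L^r
when the measure is infinite. -/
theorem exists_pos_memLp (μ : Measure X) [SigmaFinite μ] (hr0 : r ≠ 0) (hr_top : r ≠ ∞) :
    ∃ w : X → ℝ, Measurable w ∧ (∀ x, 0 < w x) ∧ MemLp (fun x => (w x : ℂ)) r μ := by
  obtain ⟨g, hg0, hgm, hg⟩ := exists_pos_lintegral_lt_of_sigmaFinite μ one_ne_zero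
  have hrpos : 0 < r.toReal := ENNReal.toReal_pos hr0 hr_top
  refine ⟨fun x => (g x : ℝ) ^ (1 / r.toReal), by fun_prop,
    fun x => Real.rpow_pos_of_pos (hg0 x) _, ?_, ?_⟩
  · exact Measurable.aestronglyMeasurable (by fun_prop)
  · rw [eLpNorm_lt_top_iff_lintegral_rpow_enorm_lt_top hr0 hr_top]
    refine lt_of_eq_of_lt (lintegral_congr fun x => ?_) (hg.trans ENNReal.one_lt_top)
    have h0 : (0 : ℝ) ≤ (g x : ℝ) ^ (1 / r.toReal) := by positivity
    rw [← ofReal_norm, Complex.norm_real, Real.norm_of_nonneg h0,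
      ENNReal.ofReal_rpow_of_nonneg h0 hrpos.le, ← Real.rpow_mul (by positivity)]
    simp [hrpos.ne']

/-- The factor I^{1/p} is cancelled, which is legitimate only for finite I. For this reason the test
functions of the duality argument are truncated. -/
theorem le_rpow_of_le_mul_rpow {p q : ℝ} (hpq : p.HolderConjugate q) {I c : ℝ≥0∞} (hI : I ≠ ∞)
    (h : I ≤ c * I ^ (1 / p)) : I ≤ c ^ q := by
  rcases eq_or_ne I 0 with rfl | h0
  · simp
  have h1 : I ^ (1 / q) * I ^ (1 / p) = I := by
    rw [← ENNReal.rpow_add _ _ h0 hI, one_div, one_div, add_comm, hpq.inv_add_inv_eq_one,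
      ENNReal.rpow_one]
  have h2 : I ^ (1 / q) ≤ c := by
    rw [← ENNReal.mul_le_mul_iff_left (c := I ^ (1 / p)), h1]
    · exact h
    · exact (ENNReal.rpow_pos (pos_iff_ne_zero.2 h0) hI).ne'
    · exact ENNReal.rpow_ne_top_of_nonneg (one_div_nonneg.2 hpq.nonneg) hI
  calc I = (I ^ (1 / q)) ^ q := by
        rw [← ENNReal.rpow_mul, one_div_mul_cancel hpq.symm.pos.ne', ENNReal.rpow_one]
    _ ≤ c ^ q := ENNReal.rpow_le_rpow h2 hpq.symm.nonneg

/-- If `φ (b w) = ∫ b h` for bounded `b`, then `h / w` belongs to `L^{r'}`. -/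
theorem memLp_div_of_functional [SigmaFinite μ] [Fact (1 ≤ r)] [Fact (1 ≤ r')]
    [ENNReal.HolderConjugate r r'] (hr : 1 < r) (hr_top : r < ∞)
    (φ : Lp ℂ r μ →L[ℂ] ℂ) {w : X → ℝ} (hwm : Measurable w) (hw0 : ∀ x, 0 < w x)
    (hw : MemLp (fun x => (w x : ℂ)) r μ) {h : X → ℂ} (hhm : Measurable h) (hh : Integrable h μ)
    (hφ : ∀ (b : X → ℂ), StronglyMeasurable b → ∀ C : ℝ, (∀ x, ‖b x‖ ≤ C) →
      ∀ F : Lp ℂ r μ, F =ᵐ[μ] (fun x => b x * w x) → φ F = ∫ x, b x * h x ∂μ) :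
    MemLp (fun x => h x / w x) r' μ := by
  classical
  have hr'top : r' ≠ ∞ := ((ENNReal.HolderConjugate.lt_top_iff_one_lt r' r).2 hr).ne
  have hr0 : r ≠ 0 := (zero_lt_one.trans hr).ne'
  have hr'0 : r' ≠ 0 := (zero_lt_one.trans_le Fact.out).ne'
  have hc : r.toReal.HolderConjugate r'.toReal :=
    ENNReal.HolderConjugate.toReal_of_ne_top hr_top.ne hr'top
  set p := r.toReal
  set q := r'.toReal
  have hq1 : 0 < q - 1 := hc.symm.sub_one_pos
  have hqp : (q - 1) * p = q := hc.symm.sub_one_mul_conj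
  set g : X → ℂ := fun x => h x / w x with hg
  have hgm : Measurable g := by fun_prop
  -- The extremal function of Hölder's inequality for g = h / w, divided by w. Restriction to `B n`
  -- bounds it by n. On `B n` it satisfies |b w|^p = |g|^q = b h, so the functional bound reads I ≤
  -- ‖φ‖ I^{1/p}.
  let B : ℕ → Set X := fun n => {x | ‖g x‖ ^ (q - 1) ≤ n * w x}
  have hB : ∀ n, MeasurableSet (B n) := fun n => measurableSet_le (by fun_prop) (by fun_prop)
  let b : ℕ → X → ℂ := fun n => (B n).indicator
    fun x => ((‖g x‖ ^ (q - 1) / w x : ℝ) : ℂ) * (starRingEnd ℂ (h x) / ‖h x‖)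
  have hbm : ∀ n, Measurable (b n) := fun n => by
    refine Measurable.indicator ?_ (hB n)
    have : Measurable fun x => starRingEnd ℂ (h x) := Complex.continuous_conj.measurable.comp hhm
    fun_prop
  have hsgn : ∀ x, ‖starRingEnd ℂ (h x) / (‖h x‖ : ℂ)‖ ≤ 1 := fun x => by
    rw [norm_div, RCLike.norm_conj, Complex.norm_real, norm_norm]
    exact div_self_le_one _
  have hbn : ∀ n x, ‖b n x‖ ≤ n := fun n x => by
    by_cases hx : x ∈ B n
    · simp only [b, Set.indicator_of_mem hx]
      rw [norm_mul, Complex.norm_real, Real.norm_of_nonneg (by have := hw0 x; positivity)]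
      refine (mul_le_of_le_one_right (by have := hw0 x; positivity) (hsgn x)).trans ?_
      exact (div_le_iff₀ (hw0 x)).2 hx
    · simp [b, hx]
  have hnorm : ∀ n x, ‖b n x * w x‖ₑ ^ p = (B n).indicator (fun x => ‖g x‖ₑ ^ q) x := by
    intro n x
    by_cases hx : x ∈ B n
    · simp only [b, Set.indicator_of_mem hx]
      rcases eq_or_ne (h x) 0 with h0 | h0
      · simp [hg, h0, hc.pos, hc.symm.pos]
      · have hn : ‖((‖g x‖ ^ (q - 1) / w x : ℝ) : ℂ) * (starRingEnd ℂ (h x) / ‖h x‖) * w x‖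
            = ‖g x‖ ^ (q - 1) := by
          have := hw0 x
          rw [norm_mul, norm_mul, norm_div (starRingEnd ℂ (h x)), RCLike.norm_conj,
            Complex.norm_real, Complex.norm_real, Complex.norm_real, norm_norm,
            div_self (norm_ne_zero_iff.2 h0), Real.norm_of_nonneg (by positivity),
            Real.norm_of_nonneg this.le]
          field_simp
        rw [← ofReal_norm, hn, ← ofReal_norm,
          ENNReal.ofReal_rpow_of_nonneg (by positivity) hc.nonneg,
          ENNReal.ofReal_rpow_of_nonneg (by positivity) hc.symm.nonneg,
          ← Real.rpow_mul (norm_nonneg _), hqp]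
    · simp [b, hx, hc.pos]
  have hmul : ∀ n x, b n x * h x = (((B n).indicator (fun x => ‖g x‖ ^ q) x : ℝ) : ℂ) := by
    intro n x
    by_cases hx : x ∈ B n
    · simp only [b, Set.indicator_of_mem hx]
      rcases eq_or_ne (h x) 0 with h0 | h0
      · simp [hg, h0, hc.symm.pos.ne']
      · have h1 : starRingEnd ℂ (h x) / ‖h x‖ * h x = (‖h x‖ : ℂ) := by
          have h2 : (‖h x‖ : ℂ) ≠ 0 := by simpa using h0
          rw [div_mul_eq_mul_div, mul_comm, Complex.mul_conj', div_eq_iff h2]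
          ring
        have h3 : ‖h x‖ = ‖g x‖ * w x := by
          have := hw0 x
          simp only [hg]
          rw [norm_div, Complex.norm_real, Real.norm_of_nonneg this.le]
          field_simp
        have h4 : 0 < ‖g x‖ := by
          have := hw0 x
          have h5 := norm_pos_iff.2 h0
          rw [h3] at h5
          exact pos_of_mul_pos_left h5 this.le
        rw [mul_assoc, h1, ← Complex.ofReal_mul, h3, Real.rpow_sub_one h4.ne']
        have := (hw0 x).ne'
        congr 1
        field_simp
    · simp [b, hx]
  have hFm : ∀ n, MemLp (fun x => b n x * w x) r μ := fun n => by
    refine (hw.const_mul (n : ℂ)).of_le ((hbm n).aestronglyMeasurable.mul hw.1)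
      (.of_forall fun x => ?_)
    rw [norm_mul, norm_mul]
    gcongr
    simpa using hbn n x
  let I : ℕ → ℝ≥0∞ := fun n => ∫⁻ x, (B n).indicator (fun x => ‖g x‖ₑ ^ q) x ∂μ
  have hint : ∀ n, Integrable (fun x => (B n).indicator (fun x => ‖g x‖ ^ q) x) μ := fun n => by
    have := hh.bdd_mul (hbm n).aestronglyMeasurable (.of_forall (hbn n))
    simp_rw [hmul] at this
    simpa using this.re
  have hIeq : ∀ n, ENNReal.ofReal (∫ x, (B n).indicator (fun x => ‖g x‖ ^ q) x ∂μ) = I n := by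
    intro n
    rw [ofReal_integral_eq_lintegral_ofReal (hint n)
      (.of_forall fun x => Set.indicator_nonneg (fun _ _ => by positivity) x)]
    refine lintegral_congr fun x => ?_
    by_cases hx : x ∈ B n
    · simp only [Set.indicator_of_mem hx]
      rw [← ofReal_norm, ENNReal.ofReal_rpow_of_nonneg (by positivity) hc.symm.nonneg]
    · simp [hx]
  have hI : ∀ n, I n ≤ ‖φ‖ₑ * I n ^ (1 / p) := by
    intro n
    have h1 := φ.le_opENorm ((hFm n).toLp _)
    rw [hφ (b n) (hbm n).stronglyMeasurable n (hbn n) _ (hFm n).coeFn_toLp, Lp.enorm_toLp,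
      eLpNorm_eq_lintegral_rpow_enorm_toReal hr0 hr_top.ne] at h1
    simp_rw [hmul, integral_complex_ofReal] at h1
    change _ ≤ ‖φ‖ₑ * (∫⁻ x, ‖b n x * w x‖ₑ ^ p ∂μ) ^ (1 / p) at h1
    simp_rw [hnorm] at h1
    rwa [← ofReal_norm, Complex.norm_real, Real.norm_of_nonneg (integral_nonneg fun x =>
      Set.indicator_nonneg (fun _ _ => by positivity) x), hIeq] at h1
  have hIb : ∀ n, I n ≤ ‖φ‖ₑ ^ q := fun n =>
    le_rpow_of_le_mul_rpow hc (by rw [← hIeq n]; exact ENNReal.ofReal_ne_top) (hI n)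
  have hlim : Tendsto I atTop (𝓝 (∫⁻ x, ‖g x‖ₑ ^ q ∂μ)) := by
    refine lintegral_tendsto_of_tendsto_of_monotone
      (fun n => ((hgm.enorm.pow_const q).indicator (hB n)).aemeasurable)
      (.of_forall fun x n m hnm => ?_) (.of_forall fun x => ?_)
    · refine Set.indicator_le_indicator_of_subset (fun y hy => ?_) (fun _ => zero_le) x
      exact (show ‖g y‖ ^ (q - 1) ≤ n * w y from hy).trans
        (mul_le_mul_of_nonneg_right (by exact_mod_cast hnm) (hw0 y).le)
    · obtain ⟨N, hN⟩ := exists_nat_ge (‖g x‖ ^ (q - 1) / w x)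
      refine tendsto_const_nhds.congr' ?_
      filter_upwards [eventually_ge_atTop N] with n hn
      rw [Set.indicator_of_mem]
      exact (div_le_iff₀ (hw0 x)).1 (hN.trans (by exact_mod_cast hn))
  refine ⟨hgm.aestronglyMeasurable, ?_⟩
  rw [eLpNorm_lt_top_iff_lintegral_rpow_enorm_lt_top hr'0 hr'top]
  exact (le_of_tendsto' hlim hIb).trans_lt
    (ENNReal.rpow_lt_top_of_nonneg hc.symm.nonneg enorm_lt_top.ne)

/-- Riesz representation: the dual of `L^r` is `L^{r'}`. -/
theorem exists_pairing_eq [SigmaFinite μ] [Fact (1 ≤ r)] [Fact (1 ≤ r')]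
    [ENNReal.HolderConjugate r r'] (hr : 1 < r) (hr_top : r < ∞) (φ : Lp ℂ r μ →L[ℂ] ℂ) :
    ∃ G : Lp ℂ r' μ, ∀ f : Lp ℂ r μ, pairing f G = φ f := by
  obtain ⟨w, hwm, hw0, hw⟩ := exists_pos_memLp μ (zero_lt_one.trans hr).ne' hr_top.ne
  obtain ⟨h, hhm, hh, hφ⟩ := exists_complex_density_of_functional hr_top.ne φ hw
  have hφb := fun (b : X → ℂ) (hb : StronglyMeasurable b) (C : ℝ) (hC : ∀ x, ‖b x‖ ≤ C)
    (F : Lp ℂ r μ) (hF : F =ᵐ[μ] (fun x => b x * w x)) =>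
      functional_eq_integral_of_bounded hr_top.ne φ hw hh hφ hb hC hF
  have hg := memLp_div_of_functional (r' := r') hr hr_top φ hwm hw0 hw hhm hh hφb
  refine ⟨hg.toLp _, fun f => ?_⟩
  -- On these sets f is w times a function bounded by n, so φ is already known on the truncations,
  -- and they converge to f in L^r.
  have hB : ∀ n : ℕ, MeasurableSet {x | ‖f x‖ ≤ n * w x} := fun n =>
    measurableSet_le (Lp.stronglyMeasurable f).norm.measurable (by fun_prop)
  have hF := fun n => (Lp.memLp f).indicator (hB n)
  have hT : Tendsto (fun n => (hF n).toLp _) atTop (𝓝 f) := by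
    refine tendsto_Lp_of_dominated hr_top.ne (Lp.memLp f).norm (fun n => ?_)
      (.of_forall fun x => le_rfl) ?_
    · filter_upwards [(hF n).coeFn_toLp] with x hx
      rw [hx]
      exact norm_indicator_le_norm_self _ _
    · filter_upwards [ae_all_iff.2 fun n => (hF n).coeFn_toLp] with x hx
      simp_rw [hx]
      obtain ⟨N, hN⟩ := exists_nat_ge (‖f x‖ / w x)
      refine tendsto_const_nhds.congr' ?_
      filter_upwards [eventually_ge_atTop N] with n hn
      rw [Set.indicator_of_mem]
      exact (div_le_iff₀ (hw0 x)).1 (hN.trans (by exact_mod_cast hn))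
  have h1 : Tendsto (fun n => φ ((hF n).toLp _)) atTop (𝓝 (φ f)) := (φ.continuous.tendsto _).comp hT
  have h2 : Tendsto (fun n => pairing ((hF n).toLp _) (hg.toLp _)) atTop
      (𝓝 (pairing f (hg.toLp _))) :=
    ((pairing.flip (hg.toLp _)).continuous.tendsto _).comp hT
  refine tendsto_nhds_unique h2 (h1.congr fun n => ?_)
  rw [pairing_eq_integral, hφb ({x | ‖f x‖ ≤ n * w x}.indicator fun x => f x / w x)
    (((Lp.stronglyMeasurable f).measurable.div
      (by fun_prop)).indicator (hB n)).stronglyMeasurable n ?_ _ ?_]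
  · refine integral_congr_ae ?_
    filter_upwards [(hF n).coeFn_toLp, hg.coeFn_toLp] with x h1 h2
    rw [h1, h2]
    by_cases hx : ‖f x‖ ≤ n * w x
    · simp [hx]; ring
    · simp [hx]
  · intro x
    by_cases hx : ‖f x‖ ≤ n * w x
    · rw [Set.indicator_of_mem (by exact hx), norm_div, Complex.norm_real,
        Real.norm_of_nonneg (hw0 x).le]
      exact (div_le_iff₀ (hw0 x)).2 hx
    · rw [Set.indicator_of_notMem (by exact hx)]
      simp
  · filter_upwards [(hF n).coeFn_toLp] with x h1
    rw [h1]
    have := (hw0 x).ne'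
    by_cases hx : ‖f x‖ ≤ n * w x
    · simp [hx, this]
    · simp [hx]

theorem pairing_comm [Fact (1 ≤ r)] [Fact (1 ≤ r')] [ENNReal.HolderConjugate r r']
    [ENNReal.HolderConjugate r' r] (f : Lp ℂ r μ) (g : Lp ℂ r' μ) :
    pairing f g = pairing g f := by
  rw [pairing_eq_integral, pairing_eq_integral]
  simp_rw [mul_comm]

/-- The isomorphism of `L^{r'}` with the dual of `L^r` given by the pairing. -/
def dualEquiv [SigmaFinite μ] [Fact (1 ≤ r)] [Fact (1 ≤ r')]
    [ENNReal.HolderConjugate r r'] (hr : 1 < r) (hr_top : r < ∞) :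
    Lp ℂ r' μ ≃L[ℂ] (Lp ℂ r μ →L[ℂ] ℂ) :=
  ContinuousLinearEquiv.ofBijective (pairing (μ := μ) (r := r) (r' := r')).flip
    (LinearMap.ker_eq_bot'.2 fun g hg => pairing_right_injective hr g fun f =>
      DFunLike.congr_fun hg f)
    (LinearMap.range_eq_top.2 fun φ => by
      obtain ⟨G, hG⟩ := exists_pairing_eq (r' := r') hr hr_top φ
      exact ⟨G, ContinuousLinearMap.ext hG⟩)

@[simp]
theorem pairing_dualEquiv_symm [SigmaFinite μ] [Fact (1 ≤ r)] [Fact (1 ≤ r')]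
    [ENNReal.HolderConjugate r r'] (hr : 1 < r) (hr_top : r < ∞) (φ : Lp ℂ r μ →L[ℂ] ℂ)
    (f : Lp ℂ r μ) : pairing f ((dualEquiv (r' := r') hr hr_top).symm φ) = φ f :=
  DFunLike.congr_fun ((dualEquiv (r' := r') hr hr_top).apply_symm_apply φ) f

theorem pairing_right_ext [SigmaFinite μ] [Fact (1 ≤ r)] [Fact (1 ≤ r')]
    [ENNReal.HolderConjugate r r'] (hr : 1 < r) {g h : Lp ℂ r' μ}
    (H : ∀ f : Lp ℂ r μ, pairing f g = pairing f h) : g = h :=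
  sub_eq_zero.1 <| pairing_right_injective hr _ fun f => by rw [map_sub, H, sub_self]

/-- The adjoint with respect to the pairing of a bounded operator between `L^p` spaces. -/
def lpAdjoint {Y : Type*} [MeasurableSpace Y] {ν : Measure Y} {s s' : ℝ≥0∞} [SigmaFinite μ]
    [Fact (1 ≤ r)] [Fact (1 ≤ r')] [Fact (1 ≤ s)] [Fact (1 ≤ s')]
    [ENNReal.HolderConjugate r r'] [ENNReal.HolderConjugate s s'] (hr : 1 < r) (hr_top : r < ∞)
    (S : Lp ℂ r μ →L[ℂ] Lp ℂ s ν) : Lp ℂ s' ν →L[ℂ] Lp ℂ r' μ :=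
  (dualEquiv (r' := r') hr hr_top).symm.toContinuousLinearMap.comp
    ((ContinuousLinearMap.compL ℂ (Lp ℂ r μ) (Lp ℂ s ν) ℂ).flip S ∘L
      (pairing (μ := ν) (r := s) (r' := s')).flip)

@[simp]
theorem pairing_lpAdjoint {Y : Type*} [MeasurableSpace Y] {ν : Measure Y} {s s' : ℝ≥0∞}
    [SigmaFinite μ] [Fact (1 ≤ r)] [Fact (1 ≤ r')] [Fact (1 ≤ s)] [Fact (1 ≤ s')]
    [ENNReal.HolderConjugate r r'] [ENNReal.HolderConjugate s s'] (hr : 1 < r) (hr_top : r < ∞)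
    (S : Lp ℂ r μ →L[ℂ] Lp ℂ s ν) (f : Lp ℂ r μ) (g : Lp ℂ s' ν) :
    pairing f (lpAdjoint (r' := r') hr hr_top S g) = pairing (S f) g := by
  simp [lpAdjoint]

end Riesz

/-! ### Smoothing semigroups and their orbits -/

section Semigroup

variable {E : Type*} [NormedAddCommGroup E] [NormedSpace ℂ E]

/-- A family of bounded operators with the semigroup law for positive times that leaves the graph
of `A` invariant and maps the whole space to `D(A)`, with `A T(t)` bounded. -/
structure IsSmoothing (A : E →ₗ.[ℂ] E) (T : ℝ → E →L[ℂ] E) : Prop where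
  map_add : ∀ s t : ℝ, 0 < s → 0 < t → T (s + t) = (T s).comp (T t)
  map_graph : ∀ t, 0 < t → ∀ f g : E, (f, g) ∈ A.graph → (T t f, T t g) ∈ A.graph
  smoothing : ∀ t, 0 < t → ∃ B : E →L[ℂ] E, ∀ f, (T t f, B f) ∈ A.graph

namespace IsSmoothing

variable {A : E →ₗ.[ℂ] E} {T : ℝ → E →L[ℂ] E}

theorem map_graph_pow (h : IsSmoothing A T) (k : ℕ) :
    ∀ t, 0 < t → ∀ f g : E, (f, g) ∈ (opPow A k).graph → (T t f, T t g) ∈ (opPow A k).graph := by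
  induction k with
  | zero =>
    intro t _ f g hfg
    simp only [opPow, LinearPMap.mem_graph_iff] at hfg ⊢
    obtain ⟨y, rfl, rfl⟩ := hfg
    exact ⟨⟨T t y, trivial⟩, rfl, rfl⟩
  | succ k ih =>
    intro t ht f g hfg
    rw [opPow, opComp_graph] at hfg ⊢
    obtain ⟨u, h1, h2⟩ := hfg
    exact ⟨T t u, ih t ht _ _ h1, h.map_graph t ht _ _ h2⟩

/-- Half of the time is spent on A^k and the other half on one more A. This works because T(t/2)
preserves the graph of A^k and maps everything into D(A). -/
theorem smoothing_pow (h : IsSmoothing A T) (k : ℕ) :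
    ∀ t, 0 < t → ∃ B : E →L[ℂ] E, ∀ f, (T t f, B f) ∈ (opPow A k).graph := by
  induction k with
  | zero =>
    intro t _
    refine ⟨T t, fun f => ?_⟩
    rw [opPow, LinearPMap.mem_graph_iff]
    exact ⟨⟨T t f, trivial⟩, rfl, rfl⟩
  | succ k ih =>
    intro t ht
    obtain ⟨B, hB⟩ := ih (t / 2) (half_pos ht)
    obtain ⟨B₁, hB₁⟩ := h.smoothing (t / 2) (half_pos ht)
    refine ⟨B₁.comp B, fun f => ?_⟩
    rw [opPow, opComp_graph, ← add_halves t, h.map_add _ _ (half_pos ht) (half_pos ht)]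
    exact ⟨T (t / 2) (B f), h.map_graph_pow k _ (half_pos ht) _ _ (hB f), hB₁ (B f)⟩

end IsSmoothing

variable {A : E →ₗ.[ℂ] E} {T : ℝ → E →L[ℂ] E}

theorem graph_unique {f g g' : E} (h : (f, g) ∈ A.graph) (h' : (f, g') ∈ A.graph) : g = g' :=
  A.mem_graph_snd_inj h h' rfl

theorem IsGenerator.map_graph (hAT : IsGenerator A T) (hT : IsC0Semigroup T) {t : ℝ}
    (ht : 0 ≤ t) {f g : E} (h : (f, g) ∈ A.graph) : (T t f, T t g) ∈ A.graph := by
  rw [hAT] at h ⊢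
  refine (((T t).continuous.tendsto g).comp h).congr' ?_
  filter_upwards [self_mem_nhdsWithin] with s hs
  have hs0 : (0 : ℝ) ≤ s := le_of_lt hs
  have : T s (T t f) = T t (T s f) := by
    rw [← ContinuousLinearMap.comp_apply, ← hT.map_add s t hs0 ht, add_comm, hT.map_add t s ht hs0,
      ContinuousLinearMap.comp_apply]
  simp [this]

theorem IsDifferentiableSemigroup.exists_graph (hd : IsDifferentiableSemigroup T)
    (hAT : IsGenerator A T) (hT : IsC0Semigroup T) {t : ℝ} (ht : 0 < t) (f : E) :
    ∃ g, (T t f, g) ∈ A.graph ∧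
      Tendsto (fun h : ℝ => ((h : ℂ)⁻¹) • (T (t + h) f - T t f)) (𝓝[≠] 0) (𝓝 g) := by
  obtain ⟨g, hg⟩ := hd f t ht
  refine ⟨g, ?_, hg⟩
  rw [hAT]
  refine (hg.mono_left (nhdsWithin_mono _ fun s hs => ne_of_gt hs)).congr' ?_
  filter_upwards [self_mem_nhdsWithin] with s hs
  rw [add_comm, hT.map_add s t (le_of_lt hs) ht.le, ContinuousLinearMap.comp_apply]

/-- Differentiable orbits lie in D(A), so A T(t) is defined everywhere. Its graph is closed since A
is closed, and the closed graph theorem makes it bounded. -/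
theorem IsGenerator.isSmoothing [CompleteSpace E] (hAT : IsGenerator A T) (hT : IsC0Semigroup T)
    (hd : IsDifferentiableSemigroup T) (hA : A.IsClosed) : IsSmoothing A T where
  map_add s t hs ht := hT.map_add s t hs.le ht.le
  map_graph t ht f g h := hAT.map_graph hT ht.le h
  smoothing t ht := by
    have hdom : ∀ f, T t f ∈ A.domain := fun f => by
      obtain ⟨g, hg, -⟩ := hd.exists_graph hAT hT ht f
      exact LinearPMap.mem_domain_iff.2 ⟨g, hg⟩
    let L : E →ₗ[ℂ] E := A.toFun ∘ₗ (T t).toLinearMap.codRestrict A.domain hdom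
    have hL : ∀ f, (T t f, L f) ∈ A.graph := fun f => A.mem_graph ⟨T t f, hdom f⟩
    refine ⟨⟨L, LinearMap.continuous_of_isClosed_graph L ?_⟩, hL⟩
    have : (L.graph : Set (E × E)) = (fun p : E × E => (T t p.1, p.2)) ⁻¹' A.graph := by
      ext p
      simp only [SetLike.mem_coe, LinearMap.mem_graph_iff, Set.mem_preimage]
      exact ⟨fun h => h ▸ hL p.1, fun h => graph_unique h (hL p.1)⟩
    rw [this]
    exact IsClosed.preimage (by fun_prop) hA

theorem IsGenerator.hasDerivAt_orbit (hAT : IsGenerator A T) (hT : IsC0Semigroup T)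
    (hd : IsDifferentiableSemigroup T) [NormedSpace ℝ E] [IsScalarTower ℝ ℂ E] {t : ℝ} (ht : 0 < t)
    {f g : E} (h : (T t f, g) ∈ A.graph) : HasDerivAt (fun t => T t f) g t := by
  obtain ⟨g', hg', hl⟩ := hd.exists_graph hAT hT ht f
  obtain rfl := graph_unique h hg'
  rw [hasDerivAt_iff_tendsto_slope_zero]
  refine hl.congr fun s => ?_
  rw [← Complex.ofReal_inv, ← algebraMap_smul ℂ (s⁻¹)]
  rfl

theorem IsGenerator.continuousOn_orbit (hAT : IsGenerator A T) (hT : IsC0Semigroup T)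
    (hd : IsDifferentiableSemigroup T) [NormedSpace ℝ E] [IsScalarTower ℝ ℂ E] (f : E) :
    ContinuousOn (fun t => T t f) (Set.Ioi 0) := fun t ht => by
  obtain ⟨g, hg, -⟩ := hd.exists_graph hAT hT ht f
  exact (hAT.hasDerivAt_orbit hT hd ht hg).continuousAt.continuousWithinAt

/-- For s > t/2 one has A T(s) f = T(s − t/2) A T(t/2) f, so the derivative is itself an orbit near
t. -/
theorem IsGenerator.continuousOn_deriv_orbit (hAT : IsGenerator A T) (hT : IsC0Semigroup T)
    (hd : IsDifferentiableSemigroup T) [NormedSpace ℝ E] [IsScalarTower ℝ ℂ E] {f : E} {v : ℝ → E}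
    (hv : ∀ t, 0 < t → (T t f, v t) ∈ A.graph) : ContinuousOn v (Set.Ioi 0) := by
  intro t ht
  have ht' : (0 : ℝ) < t := ht
  have h1 : ContinuousAt (fun s => T s (v (t / 2))) (t / 2) :=
    (hAT.continuousOn_orbit hT hd _).continuousAt (Ioi_mem_nhds (half_pos ht'))
  have h2 : ContinuousAt (fun s => T (s - t / 2) (v (t / 2))) t := by
    refine ContinuousAt.comp (g := fun s => T s (v (t / 2))) (f := fun s => s - t / 2) ?_
      (by fun_prop)
    rwa [sub_half]
  refine (h2.congr ?_).continuousWithinAt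
  filter_upwards [Ioi_mem_nhds (half_lt_self ht')] with s hs
  have hs' : 0 < s - t / 2 := sub_pos.2 hs
  have h3 := hAT.map_graph hT hs'.le (hv (t / 2) (half_pos ht'))
  rw [← ContinuousLinearMap.comp_apply, ← hT.map_add _ _ hs'.le (half_pos ht').le,
    sub_add_cancel] at h3
  exact graph_unique h3 (hv s ((half_pos ht').trans hs))

end Semigroup

/-! ### The adjoint semigroup -/

section Dual

variable {X : Type*} [MeasurableSpace X] {μ : Measure X} {r r' : ℝ≥0∞}
  [Fact (1 ≤ r)] [Fact (1 ≤ r')] [ENNReal.HolderConjugate r r']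

theorem mem_dualGraph_iff {A : Lp ℂ r μ →ₗ.[ℂ] Lp ℂ r μ} {u v : Lp ℂ r' μ} :
    (u, v) ∈ dualGraph r' A ↔ ∀ f g, (f, g) ∈ A.graph → pairing g u = pairing f v := by
  constructor
  · intro h f g hfg
    obtain ⟨y, rfl, rfl⟩ := A.mem_graph_iff.1 hfg
    exact h y
  · intro h f
    exact h _ _ (A.mem_graph f)

/-- The adjoint of the bounded operator A T(t) is A' T'(t), because A T(t) = T(t) A on D(A). Only
laws at positive times are transferred, so strong continuity of T' at 0 does not enter. -/
theorem IsSmoothing.dual [SigmaFinite μ] (hr : 1 < r) (hr_top : r < ∞) {A : Lp ℂ r μ →ₗ.[ℂ] Lp ℂ r μ}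
    {T : ℝ → Lp ℂ r μ →L[ℂ] Lp ℂ r μ} (h : IsSmoothing A T)
    (hA : Dense (A.domain : Set (Lp ℂ r μ))) :
    IsSmoothing (dualOp r' A) (fun t => lpAdjoint (r' := r') (s' := r') hr hr_top (T t)) where
  map_add s t hs ht := by
    ext1 g
    refine pairing_right_ext hr fun f => ?_
    rw [ContinuousLinearMap.comp_apply, pairing_lpAdjoint, pairing_lpAdjoint, pairing_lpAdjoint,
      add_comm, h.map_add t s ht hs, ContinuousLinearMap.comp_apply]
  map_graph t ht u v huv := by
    rw [dualOp_graph hr A hA] at huv ⊢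
    rw [mem_dualGraph_iff] at huv ⊢
    intro f g hfg
    rw [pairing_lpAdjoint, pairing_lpAdjoint]
    exact huv _ _ (h.map_graph t ht _ _ hfg)
  smoothing t ht := by
    obtain ⟨B, hB⟩ := h.smoothing t ht
    refine ⟨lpAdjoint (r' := r') (s' := r') hr hr_top B, fun u => ?_⟩
    rw [dualOp_graph hr A hA, mem_dualGraph_iff]
    intro f g hfg
    rw [pairing_lpAdjoint, pairing_lpAdjoint,
      graph_unique (hB f) (h.map_graph t ht _ _ hfg)]

end Dual

/-! ### Estimates from the Hölder norm -/

section HolderNorm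

variable {X : Type*} [EMetricSpace X]

theorem enorm_le_holderENorm (α : ℝ≥0) (g : X → ℂ) (x : X) : ‖g x‖ₑ ≤ holderENorm α g :=
  (le_iSup (fun x => ‖g x‖ₑ) x).trans le_self_add

/-- After division by the power of the distance, every Hölder constant is a bound, hence so is their
infimum. The values 0 and ∞ of that power do not allow division. At ∞ the right side is infinite
unless the norm is 0, and then g = 0. -/
theorem enorm_sub_le_holderENorm (α : ℝ≥0) {g : X → ℂ} (hg : holderENorm α g ≠ ∞) (x y : X) :
    ‖g x - g y‖ₑ ≤ holderENorm α g * edist x y ^ (α : ℝ) := by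
  obtain ⟨C, hC⟩ : MemHolder α g :=
    eHolderNorm_ne_top.1 fun h => hg (by simp [holderENorm, h])
  have hle : ∀ C : ℝ≥0, HolderWith C α g → ‖g x - g y‖ₑ ≤ C * edist x y ^ (α : ℝ) := fun C hC => by
    rw [← edist_eq_enorm_sub]
    exact hC x y
  rcases eq_or_ne (edist x y ^ (α : ℝ)) 0 with h0 | h0
  · simpa [h0] using hle C hC
  rcases eq_or_ne (edist x y ^ (α : ℝ)) ∞ with ht | ht
  · rcases eq_or_ne (holderENorm α g) 0 with hz | hz
    · have h1 : ∀ z, ‖g z‖ₑ ≤ 0 := fun z => hz ▸ enorm_le_holderENorm α g z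
      refine enorm_sub_le.trans ((add_le_add (h1 x) (h1 y)).trans ?_)
      simp
    · rw [ht, ENNReal.mul_top hz]
      exact le_top
  · rw [← ENNReal.div_le_iff h0 ht]
    exact (le_iInf₂ fun C hC => (ENNReal.div_le_iff h0 ht).2 (hle C hC)).trans le_add_self

end HolderNorm

/-! ### Hölder representatives of smoothed functions -/

section Representative

variable {X : Type*} [EMetricSpace X] [MeasurableSpace X] {μ : Measure X} {r : ℝ≥0∞}
  [Fact (1 ≤ r)]

/-- `Φ` chooses, linearly and boundedly, representatives of `S f` in `C^{0,α}`. -/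
structure IsHolderRep (α : ℝ≥0) (S : Lp ℂ r μ →L[ℂ] Lp ℂ r μ) (Φ : Lp ℂ r μ →ₗ[ℂ] (X → ℂ))
    (C : ℝ) : Prop where
  nonneg : 0 ≤ C
  ae_eq : ∀ f, Φ f =ᵐ[μ] S f
  norm_le : ∀ f x, ‖Φ f x‖ ≤ C * ‖f‖
  holder : ∀ f x y, ‖Φ f x - Φ f y‖ₑ ≤ ENNReal.ofReal (C * ‖f‖) * edist x y ^ (α : ℝ)

theorem EmbedsInHolder.exists_isHolderRep {B : Lp ℂ r μ →ₗ.[ℂ] Lp ℂ r μ} {α : ℝ≥0}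
    (hB : EmbedsInHolder B α) {S R : Lp ℂ r μ →L[ℂ] Lp ℂ r μ} (hS : ∀ f, (S f, R f) ∈ B.graph) :
    ∃ Φ C, IsHolderRep α S Φ C := by
  obtain ⟨J, C, hJ⟩ := hB
  have hdom : ∀ f, S f ∈ B.domain := fun f => LinearPMap.mem_domain_iff.2 ⟨_, hS f⟩
  have hval : ∀ f, B ⟨S f, hdom f⟩ = R f := fun f => graph_unique (B.mem_graph ⟨S f, hdom f⟩) (hS f)
  let Φ : Lp ℂ r μ →ₗ[ℂ] (X → ℂ) := J ∘ₗ S.toLinearMap.codRestrict B.domain hdom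
  have hC : 0 ≤ (C : ℝ) * (‖S‖ + ‖R‖) := by positivity
  have key : ∀ f, holderENorm α (Φ f) ≤ ENNReal.ofReal (C * (‖S‖ + ‖R‖) * ‖f‖) := fun f => by
    refine (hJ ⟨S f, hdom f⟩).2.trans ?_
    rw [hval, ← ENNReal.ofReal_coe_nnreal, ← ENNReal.ofReal_mul C.coe_nonneg, mul_assoc]
    refine ENNReal.ofReal_le_ofReal (mul_le_mul_of_nonneg_left ?_ C.coe_nonneg)
    rw [add_mul]
    exact add_le_add (S.le_opNorm f) (R.le_opNorm f)
  refine ⟨Φ, C * (‖S‖ + ‖R‖), hC, fun f => (hJ ⟨S f, hdom f⟩).1, fun f x => ?_, fun f x y => ?_⟩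
  · have := (enorm_le_holderENorm α (Φ f) x).trans (key f)
    rwa [← ofReal_norm, ENNReal.ofReal_le_ofReal_iff (by positivity)] at this
  · refine (enorm_sub_le_holderENorm α ((key f).trans_lt ENNReal.ofReal_lt_top).ne x y).trans ?_
    gcongr
    exact key f

end Representative

/-! ### Maps from a Hilbert space to bounded functions -/

section HilbertSchmidt

variable {H : Type*} [NormedAddCommGroup H] [InnerProductSpace ℂ H] [CompleteSpace H]
  {X : Type*} [MeasurableSpace X] {ν : Measure X} [IsFiniteMeasure ν]

/-- A linear map from a Hilbert space to bounded functions annihilates almost everywhere all but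
countably many vectors of a Hilbert basis. -/
theorem countable_not_ae_eq_zero {ι : Type*} (b : HilbertBasis ι ℂ H) (Ψ : H →ₗ[ℂ] (X → ℂ)) {C : ℝ}
    (hC0 : 0 ≤ C) (hC : ∀ h x, ‖Ψ h x‖ ≤ C * ‖h‖) (hm : ∀ h, AEStronglyMeasurable (Ψ h) ν) :
    {i | ¬ Ψ (b i) =ᵐ[ν] 0}.Countable := by
  -- For fixed x the evaluation h ↦ Ψ h x has norm at most C. Bessel's inequality for its Riesz
  -- vector gives a bound independent of x and s.
  have hbessel : ∀ (s : Finset ι) x, ∑ i ∈ s, ‖Ψ (b i) x‖ ^ 2 ≤ C ^ 2 := by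
    intro s x
    let ℓ : H →L[ℂ] ℂ := LinearMap.mkContinuous (LinearMap.proj x ∘ₗ Ψ) C (fun h => hC h x)
    let a := (InnerProductSpace.toDual ℂ H).symm ℓ
    have h1 : ∀ i, ‖Ψ (b i) x‖ = ‖inner ℂ (b i) a‖ := fun i => by
      rw [norm_inner_symm, InnerProductSpace.toDual_symm_apply]
      rfl
    simp_rw [h1]
    refine (b.orthonormal.sum_inner_products_le a).trans ?_
    have h2 : ‖a‖ ≤ C := by
      rw [LinearIsometryEquiv.norm_map]
      exact LinearMap.mkContinuous_norm_le _ hC0 _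
    gcongr
  have hint : ∀ i, Integrable (fun x => ‖Ψ (b i) x‖ ^ 2) ν := fun i => by
    refine Integrable.of_bound ((hm _).norm.pow 2) (C ^ 2) (.of_forall fun x => ?_)
    rw [Real.norm_of_nonneg (by positivity)]
    simpa using hbessel {i} x
  -- Integration of the uniform bound over a finite measure: Ψ is Hilbert–Schmidt into L²(ν). A
  -- summable family has countable support.
  have hsum : Summable fun i => ∫ x, ‖Ψ (b i) x‖ ^ 2 ∂ν := by
    refine summable_of_sum_le (c := ∫ _, C ^ 2 ∂ν) (fun i => integral_nonneg fun x => by positivity)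
      fun s => ?_
    rw [← integral_finsetSum _ fun i _ => hint i]
    exact integral_mono (integrable_finsetSum _ fun i _ => hint i) (integrable_const _)
      fun x => hbessel s x
  refine hsum.countable_support.mono fun i hi => Function.mem_support.2 fun h0 => hi ?_
  have h1 := (integral_eq_zero_iff_of_nonneg (fun x => by positivity) (hint i)).1 h0
  filter_upwards [h1] with x hx
  simpa using hx

/-- The vectors orthogonal to the kernel of `Ψ` lie in every closed subspace that contains a
certain countable set. -/
theorem exists_countable_forall_mem_of_isClosed (Ψ : H →ₗ[ℂ] (X → ℂ)) {C : ℝ}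
    (hC0 : 0 ≤ C) (hC : ∀ h x, ‖Ψ h x‖ ≤ C * ‖h‖) (hm : ∀ h, AEStronglyMeasurable (Ψ h) ν) :
    ∃ D : Set H, D.Countable ∧ ∀ G : H, (∀ h, Ψ h =ᵐ[ν] 0 → inner ℂ G h = 0) →
      ∀ N : Submodule ℂ H, IsClosed (N : Set H) → D ⊆ N → G ∈ N := by
  obtain ⟨ι, b, -⟩ := exists_hilbertBasis ℂ H
  refine ⟨b '' {i | ¬ Ψ (b i) =ᵐ[ν] 0}, (countable_not_ae_eq_zero b Ψ hC0 hC hm).image _,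
    fun G hG N hN hD => ?_⟩
  refine hN.mem_of_tendsto (b.hasSum_repr G) (.of_forall fun s => ?_)
  refine N.sum_mem fun i _ => ?_
  by_cases hi : Ψ (b i) =ᵐ[ν] 0
  · rw [b.repr_apply_apply, ← inner_conj_symm, hG _ hi]
    simp
  · exact N.smul_mem _ (hD ⟨i, hi, rfl⟩)

end HilbertSchmidt

/-! ### Pettis measurability -/

section Pettis

/-- By Lusin–Souslin, a continuous injection of a Polish space into ℂ^ℕ is a measurable embedding,
so measurability can be tested coordinatewise. -/
theorem aestronglyMeasurable_of_separating {X E : Type*} [MeasurableSpace X] {μ : Measure X}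
    [TopologicalSpace E] [PolishSpace E] (e : ℕ → E → ℂ) (he : ∀ n, Continuous (e n))
    (hinj : ∀ x y, (∀ n, e n x = e n y) → x = y) {F : X → E}
    (hF : ∀ n, AEMeasurable (fun x => e n (F x)) μ) : AEStronglyMeasurable F μ := by
  borelize E
  have hemb : MeasurableEmbedding (fun x n => e n x) :=
    Continuous.measurableEmbedding (by fun_prop) fun x y hxy => hinj x y (congrFun hxy)
  exact (hemb.aemeasurable_comp_iff.1 (aemeasurable_pi_iff.2 hF)).aestronglyMeasurable

variable {Y : Type*} [MeasurableSpace Y] {ν : Measure Y} [SigmaFinite ν]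
  [MeasurableSpace.CountablyGenerated Y] {X : Type*} [MeasurableSpace X] {μ : Measure X}
  {r r' : ℝ≥0∞} [Fact (1 ≤ r)] [Fact (1 ≤ r')] [ENNReal.HolderConjugate r r']

/-- Pettis' theorem for separable `L^{r'}`. -/
theorem aestronglyMeasurable_of_pairing (hr : 1 < r) (hr_top : r < ∞) {F : X → Lp ℂ r' ν}
    (hF : ∀ f : Lp ℂ r ν, AEMeasurable (fun x => pairing f (F x)) μ) :
    AEStronglyMeasurable F μ := by
  have hr'top : r' < ∞ := (ENNReal.HolderConjugate.lt_top_iff_one_lt r' r).2 hr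
  have : Fact (r ≠ ∞) := ⟨hr_top.ne⟩
  have : Fact (r' ≠ ∞) := ⟨hr'top.ne⟩
  refine aestronglyMeasurable_of_separating
    (fun n g => pairing (TopologicalSpace.denseSeq (Lp ℂ r ν) n) g) (fun n => by fun_prop)
    (fun g h hgh => pairing_right_ext hr fun f => ?_) fun n => hF _
  have h1 : IsClosed {f : Lp ℂ r ν | pairing f g = pairing f h} :=
    isClosed_eq (pairing.flip g).continuous (pairing.flip h).continuous
  exact isClosed_property (TopologicalSpace.denseRange_denseSeq _) h1 hgh f

end Pettis

/-! ### Tools for the passage to a coarser space -/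

section Coarse

variable {X : Type*} [MeasurableSpace X] {μ : Measure X} {r r' : ℝ≥0∞}

/-- Markov's inequality bounds the superlevel sets of |f|. It is needed because an image of a
σ-finite measure need not be σ-finite. -/
theorem sigmaFinite_of_pos_memLp {p : ℝ≥0∞} (hp0 : p ≠ 0) (hp : p ≠ ∞) {f : X → ℂ}
    (hfm : Measurable f) (hf : MemLp f p μ) (h0 : ∀ᵐ x ∂μ, f x ≠ 0) : SigmaFinite μ := by
  have hB : ∀ n : ℕ, MeasurableSet {x | ((n : ℝ≥0∞) + 1)⁻¹ ≤ ‖f x‖ₑ} := fun n =>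
    measurableSet_le measurable_const hfm.enorm
  refine ⟨⟨{ set := fun n => {x | ((n : ℝ≥0∞) + 1)⁻¹ ≤ ‖f x‖ₑ} ∪ {x | f x = 0}
             set_mem := fun n => trivial
             finite := fun n => ?_
             spanning := ?_ }⟩⟩
  · refine (measure_union_le _ _).trans_lt (ENNReal.add_lt_top.2 ⟨?_, ?_⟩)
    · refine (meas_ge_le_mul_pow_eLpNorm_enorm μ hp0 hp hf.1 (by simp) (by simp)).trans_lt ?_
      exact ENNReal.mul_lt_top (ENNReal.rpow_lt_top_of_nonneg ENNReal.toReal_nonneg (by simp))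
        (ENNReal.rpow_lt_top_of_nonneg ENNReal.toReal_nonneg hf.2.ne)
    · have : μ {x | f x = 0} = 0 := by simpa [ae_iff] using h0
      simp [this]
  · refine Set.eq_univ_of_forall fun x => Set.mem_iUnion.2 ?_
    by_cases hx : f x = 0
    · exact ⟨0, Or.inr hx⟩
    · obtain ⟨n, hn⟩ := ENNReal.exists_inv_nat_lt (a := ‖f x‖ₑ) (by simpa using hx)
      refine ⟨n, Or.inl (le_trans ?_ hn.le)⟩
      exact ENNReal.inv_le_inv.2 le_self_add

variable [EMetricSpace X]

/-- `g ↦ w Φ(g)` as a bounded operator to `L²`. -/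
theorem exists_mul_toL2 [Fact (1 ≤ r)] {α : ℝ≥0} {S : Lp ℂ r μ →L[ℂ] Lp ℂ r μ}
    {Φ : Lp ℂ r μ →ₗ[ℂ] (X → ℂ)} {C : ℝ} (hΦ : IsHolderRep α S Φ C) {w : X → ℂ} (hw : MemLp w 2 μ) :
    ∃ M : Lp ℂ r μ →L[ℂ] Lp ℂ 2 μ, ∀ g, M g =ᵐ[μ] fun x => w x * S g x := by
  have hle : ∀ g, ∀ᵐ x ∂μ, ‖w x * S g x‖ ≤ C * ‖g‖ * ‖w x‖ := fun g => by
    filter_upwards [hΦ.ae_eq g] with x hx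
    rw [← hx, norm_mul, mul_comm]
    gcongr
    exact hΦ.norm_le g x
  have hm : ∀ g, MemLp (fun x => w x * S g x) 2 μ := fun g =>
    hw.of_le_mul (hw.1.mul (Lp.aestronglyMeasurable _)) (hle g)
  let L : Lp ℂ r μ →ₗ[ℂ] Lp ℂ 2 μ :=
    { toFun := fun g => (hm g).toLp _
      map_add' := fun g h => by
        apply Lp.ext
        filter_upwards [(hm (g + h)).coeFn_toLp, (hm g).coeFn_toLp, (hm h).coeFn_toLp,
          Lp.coeFn_add ((hm g).toLp _) ((hm h).toLp _), Lp.coeFn_add (S g) (S h)] with x h1 h2 h3 h4 h5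
        rw [h1, h4, Pi.add_apply, h2, h3, map_add, h5, Pi.add_apply, mul_add]
      map_smul' := fun c g => by
        apply Lp.ext
        filter_upwards [(hm (c • g)).coeFn_toLp, (hm g).coeFn_toLp,
          Lp.coeFn_smul c ((hm g).toLp _), Lp.coeFn_smul c (S g)] with x h1 h2 h4 h5
        rw [h1, RingHom.id_apply, h4, Pi.smul_apply, h2, map_smul, h5, Pi.smul_apply,
          smul_eq_mul, smul_eq_mul, mul_left_comm] }
  refine ⟨L.mkContinuous (C * ‖hw.toLp w‖) fun g => ?_, fun g => (hm g).coeFn_toLp⟩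
  rw [mul_right_comm]
  refine Lp.norm_le_mul_norm_of_ae_le_mul ?_
  filter_upwards [(hm g).coeFn_toLp, hle g, hw.coeFn_toLp] with x h1 h2 h3
  rw [h3]
  exact (congrArg norm h1).trans_le h2

/-- Integration of `Φ f` against a bounded function is represented by an element of `L^{r'}`. -/
theorem exists_pairing_eq_integral_rep [SigmaFinite μ] [Fact (1 ≤ r)] [Fact (1 ≤ r')]
    [ENNReal.HolderConjugate r r'] (hr : 1 < r) (hr_top : r < ∞) {α : ℝ≥0}
    {S : Lp ℂ r μ →L[ℂ] Lp ℂ r μ} {Φ : Lp ℂ r μ →ₗ[ℂ] (X → ℂ)} {C : ℝ} (hΦ : IsHolderRep α S Φ C)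
    {ν : Measure X} [IsFiniteMeasure ν] (hν : ν ≪ μ) {u : X → ℂ} (hu : AEStronglyMeasurable u ν)
    {K : ℝ} (hK : ∀ x, ‖u x‖ ≤ K) :
    ∃ m : Lp ℂ r' μ, ∀ f : Lp ℂ r μ, pairing f m = ∫ x, u x * Φ f x ∂ν := by
  have hm : ∀ f, AEStronglyMeasurable (Φ f) ν := fun f =>
    ((Lp.aestronglyMeasurable (S f)).congr (hΦ.ae_eq f).symm).mono_ac hν
  have hint : ∀ f, Integrable (fun x => u x * Φ f x) ν := fun f => by
    refine Integrable.bdd_mul ?_ hu (.of_forall hK)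
    exact Integrable.of_bound (hm f) _ (.of_forall (hΦ.norm_le f))
  let L : Lp ℂ r μ →ₗ[ℂ] ℂ :=
    { toFun := fun f => ∫ x, u x * Φ f x ∂ν
      map_add' := fun f g => by
        rw [← integral_add (hint f) (hint g)]
        simp [mul_add]
      map_smul' := fun c f => by
        rw [RingHom.id_apply, smul_eq_mul, ← integral_const_mul]
        simp [mul_left_comm] }
  let φ : Lp ℂ r μ →L[ℂ] ℂ := L.mkContinuous (K * C * ν.real Set.univ) fun f => by
    refine (norm_integral_le_of_norm_le_const (C := K * (C * ‖f‖)) (.of_forall fun x => ?_)).trans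
      (le_of_eq (by ring))
    rw [norm_mul]
    exact mul_le_mul (hK x) (hΦ.norm_le f x) (norm_nonneg _) ((norm_nonneg _).trans (hK x))
  exact exists_pairing_eq hr hr_top φ

end Coarse

/-! ### Reduction to a countably generated space -/

section Factor

universe u

variable {X : Type u} [MeasurableSpace X] {μ : Measure X} {r r' : ℝ≥0∞}

theorem mem_range_compMeasurePreserving {Y : Type*} [MeasurableSpace Y] {φ : X → Y}
    (hφ : Measurable φ) {p : ℝ≥0∞} [Fact (1 ≤ p)] {f : Lp ℂ p μ} {k : Y → ℂ}
    (hk : AEStronglyMeasurable k (μ.map φ)) (hf : f =ᵐ[μ] k ∘ φ) :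
    ∃ g : Lp ℂ p (μ.map φ), Lp.compMeasurePreserving φ (hφ.measurePreserving μ) g = f := by
  have hkm : MemLp k p (μ.map φ) :=
    (memLp_map_measure_iff hk hφ.aemeasurable).2 ((memLp_congr_ae hf).1 (Lp.memLp f))
  refine ⟨hkm.toLp k, ?_⟩
  rw [Lp.toLp_compMeasurePreserving hkm (hφ.measurePreserving μ)]
  exact Lp.ext ((MemLp.coeFn_toLp _).trans hf.symm)

/-- There is a measurable map to a countably generated space such that `Φ ∘ S` annihilates almost
everywhere all functions that are orthogonal to the functions which factor through it. -/
theorem exists_countablyGenerated_factor [EMetricSpace X] [SigmaFinite μ] [Fact (1 ≤ r)]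
    [Fact (1 ≤ r')] [ENNReal.HolderConjugate r r'] (hr : 1 < r) (hr_top : r < ∞) {α : ℝ≥0}
    {S : Lp ℂ r μ →L[ℂ] Lp ℂ r μ} {S' : Lp ℂ r' μ →L[ℂ] Lp ℂ r' μ}
    (hS : ∀ f g, pairing (S f) g = pairing f (S' g))
    {Φ : Lp ℂ r μ →ₗ[ℂ] (X → ℂ)} {Φ' : Lp ℂ r' μ →ₗ[ℂ] (X → ℂ)} {C C' : ℝ}
    (hΦ : IsHolderRep α S Φ C) (hΦ' : IsHolderRep α S' Φ' C') :
    ∃ (Y : Type u) (_ : MeasurableSpace Y) (_ : MeasurableSpace.CountablyGenerated Y) (φ : X → Y)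
      (hφ : Measurable φ), SigmaFinite (μ.map φ) ∧ ∀ f : Lp ℂ r μ,
        (∀ g : Lp ℂ r' (μ.map φ),
          pairing f (Lp.compMeasurePreserving φ (hφ.measurePreserving μ) g) = 0) →
        Φ (S f) =ᵐ[μ] 0 := by
  have : ENNReal.HolderConjugate r' r := ENNReal.HolderConjugate.symm
  have hr' : 1 < r' := (ENNReal.HolderConjugate.lt_top_iff_one_lt r r').1 hr_top
  have hr'top : r' < ∞ := (ENNReal.HolderConjugate.lt_top_iff_one_lt r' r).2 hr
  obtain ⟨w, hwm, hw0, hw⟩ := exists_pos_memLp (r := 2) μ (by simp) (by simp)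
  obtain ⟨M, hM⟩ := exists_mul_toL2 hΦ' hw
  -- Formally j h = S (w h). Defining it as an adjoint avoids asking that w h belong to L^r.
  let j : Lp ℂ 2 μ →L[ℂ] Lp ℂ r μ := lpAdjoint (r' := r) (s' := 2) hr' hr'top M
  have hj : ∀ h g, pairing g (j h) = pairing (M g) h := fun h g => by simp [j]
  let ν := μ.toFinite
  have hνμ : ν ≪ μ := toFinite_absolutelyContinuous μ
  have hm : ∀ f, AEStronglyMeasurable (Φ f) ν := fun f =>
    ((Lp.aestronglyMeasurable (S f)).congr (hΦ.ae_eq f).symm).mono_ac hνμ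
  obtain ⟨D, hDc, hD⟩ := exists_countable_forall_mem_of_isClosed (ν := ν)
    (Φ ∘ₗ j.toLinearMap) (C := C * ‖j‖) (mul_nonneg hΦ.nonneg (norm_nonneg _)) (fun h x =>
      (hΦ.norm_le (j h) x).trans (by
        rw [mul_assoc]
        exact mul_le_mul_of_nonneg_left (j.le_opNorm h) hΦ.nonneg)) (fun h => hm (j h))
  have : Countable D := hDc
  -- The coordinate w keeps the image measure σ-finite and allows division by w below. The other
  -- coordinates make every element of D factor through φ.
  let φ : X → ℂ × (D → ℂ) := fun x => ((w x : ℂ), fun d => (d : Lp ℂ 2 μ) x)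
  have hφ : Measurable φ := by
    refine Measurable.prodMk (by fun_prop) (measurable_pi_lambda _ fun d => ?_)
    exact (Lp.stronglyMeasurable _).measurable
  refine ⟨ℂ × (D → ℂ), inferInstance, inferInstance, φ, hφ, ?_, fun f₀ hf₀ => ?_⟩
  · refine sigmaFinite_of_pos_memLp (p := 2) (f := Prod.fst) (by simp) (by simp) measurable_fst
      ((memLp_map_measure_iff measurable_fst.aestronglyMeasurable hφ.aemeasurable).2 hw) ?_
    refine (ae_map_iff hφ.aemeasurable (p := fun y => y.1 ≠ 0)
      (measurableSet_eq_fun measurable_fst measurable_const).compl).2 (.of_forall fun x => ?_)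
    simpa [φ] using (hw0 x).ne'
  -- With this u the functional f ↦ ∫ u Φ f dν takes the value ∫ |Φ (S f₀)|² dν at S f₀.
  let u : X → ℂ := fun x => starRingEnd ℂ (Φ (S f₀) x)
  obtain ⟨m, hmu⟩ := exists_pairing_eq_integral_rep (r' := r') hr hr_top hΦ hνμ (u := u)
    (Complex.continuous_conj.comp_aestronglyMeasurable (hm _)) (K := C * ‖S f₀‖)
    (fun x => by simpa [u] using hΦ.norm_le (S f₀) x)
  -- the element of `L²` that corresponds to the functional `h ↦ ∫ u Φ (j h)`
  have hGm : MemLp (fun x => starRingEnd ℂ (M m x)) 2 μ :=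
    (Lp.memLp (M m)).of_le
      (Complex.continuous_conj.comp_aestronglyMeasurable (Lp.aestronglyMeasurable _)) (.of_forall fun x => by simp)
  have hinner : ∀ h, inner ℂ (hGm.toLp _) h = pairing (M m) h := fun h => by
    rw [L2.inner_def, pairing_eq_integral]
    refine integral_congr_ae ?_
    filter_upwards [hGm.coeFn_toLp] with x hx
    rw [hx]
    simp [mul_comm]
  let N : Submodule ℂ (Lp ℂ 2 μ) := LinearMap.range
    (Lp.compMeasurePreservingₗᵢ ℂ φ (hφ.measurePreserving μ) (E := ℂ) (p := 2)).toLinearMap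
  have hN : IsClosed (N : Set (Lp ℂ 2 μ)) :=
    (Lp.isometry_compMeasurePreserving (hφ.measurePreserving μ)).isClosedEmbedding.isClosed_range
  -- The vector conj (w S' m) represents h ↦ ∫ u Φ(j h) dν. It is therefore orthogonal to every h
  -- with Φ (j h) = 0 a.e. and lies in the closed subspace N, which contains D.
  obtain ⟨G, hG⟩ : hGm.toLp _ ∈ N := by
    refine hD _ (fun h hh => ?_) N hN fun d hd => ?_
    · rw [hinner, ← hj, pairing_comm, hmu]
      rw [← integral_zero X ℂ (μ := ν)]
      refine integral_congr_ae ?_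
      filter_upwards [hh] with x hx
      change u x * (Φ ∘ₗ j.toLinearMap) h x = 0
      rw [hx, Pi.zero_apply, mul_zero]
    · exact mem_range_compMeasurePreserving hφ (k := fun y => y.2 ⟨d, hd⟩)
        (Measurable.aestronglyMeasurable (by fun_prop)) (.of_forall fun x => rfl)
  have hG' : hGm.toLp _ =ᵐ[μ] G ∘ φ := by
    rw [← hG]
    exact Lp.coeFn_compMeasurePreserving G (hφ.measurePreserving μ)
  -- Conjugation and division by w show that S' m itself factors through φ. Hence ⟨S f₀, m⟩ = ⟨f₀,
  -- S' m⟩ = 0.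
  obtain ⟨g, hg⟩ := mem_range_compMeasurePreserving (p := r') (f := S' m) hφ
    (k := fun y => starRingEnd ℂ (G y) / y.1)
    (((Complex.continuous_conj.measurable.comp (Lp.stronglyMeasurable G).measurable).div
      measurable_fst).aestronglyMeasurable) (by
      filter_upwards [hG', hGm.coeFn_toLp, hM m] with x h1 h2 h3
      have h4 : G (φ x) = starRingEnd ℂ (w x * S' m x) := by
        rw [← h3, ← h2, h1, Function.comp_apply]
      have h5 : (w x : ℂ) ≠ 0 := by exact_mod_cast (hw0 x).ne'
      change S' m x = starRingEnd ℂ (G (φ x)) / (w x : ℂ)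
      rw [h4, Complex.conj_conj]
      field_simp)
  have h0 : ∫ x, u x * Φ (S f₀) x ∂ν = 0 := by
    rw [← hmu, hS, ← hg, hf₀]
  have h1 : ∫ x, ‖Φ (S f₀) x‖ ^ 2 ∂ν = 0 := by
    have : ∀ x, u x * Φ (S f₀) x = ((‖Φ (S f₀) x‖ ^ 2 : ℝ) : ℂ) := fun x => by
      rw [Complex.conj_mul', Complex.ofReal_pow]
    simp_rw [this] at h0
    rw [integral_complex_ofReal] at h0
    exact_mod_cast h0
  have h2 := (integral_eq_zero_iff_of_nonneg (fun x => by positivity) (by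
    refine Integrable.of_bound ((hm _).norm.pow 2) ((C * ‖S f₀‖) ^ 2) (.of_forall fun x => ?_)
    rw [Real.norm_of_nonneg (by positivity)]
    gcongr
    exact hΦ.norm_le _ x)).1 h1
  have h3 : ∀ᵐ x ∂ν, Φ (S f₀) x = 0 := by
    filter_upwards [h2] with x hx
    simpa using hx
  exact (absolutelyContinuous_toFinite μ).ae_le h3

end Factor

/-! ### Vector-valued Hölder maps -/

section BoundedHolder

variable {X : Type*} [EMetricSpace X]

/-- Bounded Hölder continuous functions with values in a normed space. -/
def IsBoundedHolder {E : Type*} [NormedAddCommGroup E] (α : ℝ≥0) (F : X → E) : Prop :=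
  ∃ L : ℝ≥0, (∀ x, ‖F x‖ ≤ L) ∧ ∀ x y, ‖F x - F y‖ₑ ≤ L * edist x y ^ (α : ℝ)

theorem IsBoundedHolder.clm_comp {E F : Type*} [NormedAddCommGroup E] [NormedSpace ℂ E]
    [NormedAddCommGroup F] [NormedSpace ℂ F] {α : ℝ≥0} {κ : X → E} (h : IsBoundedHolder α κ)
    (K : E →L[ℂ] F) : IsBoundedHolder α (fun x => K (κ x)) := by
  obtain ⟨L, h1, h2⟩ := h
  refine ⟨‖K‖₊ * L, fun x => ?_, fun x y => ?_⟩
  · exact (K.le_opNorm _).trans (mul_le_mul_of_nonneg_left (h1 x) (norm_nonneg _))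
  · rw [← map_sub, ENNReal.coe_mul, mul_assoc]
    exact (K.le_opENorm _).trans (mul_le_mul_right (h2 x y) _)

theorem IsBoundedHolder.continuous {E : Type*} [NormedAddCommGroup E] {α : ℝ≥0} (hα : 0 < α)
    {κ : X → E} (h : IsBoundedHolder α κ) : Continuous κ := by
  obtain ⟨L, -, h2⟩ := h
  have : HolderWith L α κ := fun x y => by
    rw [edist_eq_enorm_sub]
    exact h2 x y
  exact this.continuous hα

variable [MeasurableSpace X] {μ : Measure X} {r : ℝ≥0∞} [Fact (1 ≤ r)]

/-- Point evaluations of a Hölder representative depend Hölder continuously on the point. -/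
theorem IsHolderRep.exists_eval {α : ℝ≥0} {S : Lp ℂ r μ →L[ℂ] Lp ℂ r μ}
    {Φ : Lp ℂ r μ →ₗ[ℂ] (X → ℂ)} {C : ℝ} (hΦ : IsHolderRep α S Φ C) :
    ∃ δ : X → (Lp ℂ r μ →L[ℂ] ℂ), (∀ x f, δ x f = Φ f x) ∧ IsBoundedHolder α δ := by
  have hC := hΦ.nonneg
  let δ : X → (Lp ℂ r μ →L[ℂ] ℂ) := fun x =>
    LinearMap.mkContinuous (LinearMap.proj x ∘ₗ Φ) C fun f => hΦ.norm_le f x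
  -- C + 1 instead of C keeps the constant positive, so that its product with ∞ is ∞ and infinite
  -- distances need no further distinction.
  refine ⟨δ, fun x f => rfl, Real.toNNReal (C + 1), fun x => ?_, fun x y => ?_⟩
  · rw [Real.coe_toNNReal _ (by positivity)]
    exact (LinearMap.mkContinuous_norm_le _ hC _).trans (by linarith)
  · rcases eq_or_ne (edist x y ^ (α : ℝ)) ∞ with ht | ht
    · rw [ht, ENNReal.mul_top]
      · exact le_top
      · simp only [ne_eq, ENNReal.coe_eq_zero, Real.toNNReal_eq_zero, not_le]
        positivity
    · have h1 : ‖δ x - δ y‖ ≤ (C + 1) * (edist x y ^ (α : ℝ)).toReal := by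
        refine ContinuousLinearMap.opNorm_le_bound _ (by positivity) fun f => ?_
        have h2 : ‖Φ f x - Φ f y‖ₑ ≤ _ := hΦ.holder f x y
        rw [← ofReal_norm, ← ENNReal.ofReal_toReal ht, ← ENNReal.ofReal_mul (by positivity),
          ENNReal.ofReal_le_ofReal_iff (by positivity)] at h2
        refine h2.trans ?_
        rw [mul_right_comm]
        gcongr
        linarith
      rw [← ofReal_norm]
      refine (ENNReal.ofReal_le_ofReal h1).trans (le_of_eq ?_)
      rw [ENNReal.ofReal_mul (by positivity), ENNReal.ofReal_toReal ht]
      rfl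

end BoundedHolder

/-! ### Construction of the vector-valued kernel -/

section Kernel

universe u

variable {X : Type u} [EMetricSpace X] [MeasurableSpace X] {μ : Measure X} [SigmaFinite μ]
  {r r' : ℝ≥0∞} [Fact (1 ≤ r)] [Fact (1 ≤ r')] [ENNReal.HolderConjugate r r']

/-- `κ` is a kernel of the operator `S`: it is Hölder continuous and measurable with values in
`L^{r'}`, and `S f = ⟨f, κ⟩` almost everywhere. -/
structure IsKernelOf (α : ℝ≥0) (S : Lp ℂ r μ →L[ℂ] Lp ℂ r μ) (κ : X → Lp ℂ r' μ) : Prop where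
  holder : IsBoundedHolder α κ
  aestronglyMeasurable : AEStronglyMeasurable κ μ
  stronglyMeasurable : OpensMeasurableSpace X → StronglyMeasurable κ
  ae_eq : ∀ f : Lp ℂ r μ, S f =ᵐ[μ] fun x => pairing f (κ x)

/-- The functional f ↦ Φ (S f)(x) is restricted to functions factoring through φ and represented in
L^{r'} of the image measure. That space is separable, so measurability follows from Pettis, and the
pullback of the representing element is κ(x). Restriction loses nothing for a.e. x by the choice of
φ. One S serves the representative Φ and the other the factorization, whence S ∘ S. -/
theorem exists_isKernelOf (hr : 1 < r) (hr_top : r < ∞) {α : ℝ≥0} (hα : 0 < α)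
    {S : Lp ℂ r μ →L[ℂ] Lp ℂ r μ} {S' : Lp ℂ r' μ →L[ℂ] Lp ℂ r' μ}
    (hS : ∀ f g, pairing (S f) g = pairing f (S' g))
    {Φ : Lp ℂ r μ →ₗ[ℂ] (X → ℂ)} {Φ' : Lp ℂ r' μ →ₗ[ℂ] (X → ℂ)} {C C' : ℝ}
    (hΦ : IsHolderRep α S Φ C) (hΦ' : IsHolderRep α S' Φ' C') :
    ∃ κ : X → Lp ℂ r' μ, IsKernelOf α (S.comp S) κ := by
  have : ENNReal.HolderConjugate r' r := ENNReal.HolderConjugate.symm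
  have hr' : 1 < r' := (ENNReal.HolderConjugate.lt_top_iff_one_lt r r').1 hr_top
  have hr'top : r' < ∞ := (ENNReal.HolderConjugate.lt_top_iff_one_lt r' r).2 hr
  have : Fact (r' ≠ ∞) := ⟨hr'top.ne⟩
  obtain ⟨Y, _, _, φ, hφ, _, hker⟩ := exists_countablyGenerated_factor hr hr_top hS hΦ hΦ'
  have hmp := hφ.measurePreserving μ
  let ι : Lp ℂ r (μ.map φ) →L[ℂ] Lp ℂ r μ :=
    (Lp.compMeasurePreservingₗᵢ ℂ φ hmp).toContinuousLinearMap
  let ι' : Lp ℂ r' (μ.map φ) →L[ℂ] Lp ℂ r' μ :=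
    (Lp.compMeasurePreservingₗᵢ ℂ φ hmp).toContinuousLinearMap
  have hι : ∀ f, ι f =ᵐ[μ] f ∘ φ := fun f => Lp.coeFn_compMeasurePreserving f hmp
  have hι' : ∀ f, ι' f =ᵐ[μ] f ∘ φ := fun f => Lp.coeFn_compMeasurePreserving f hmp
  have hpair : ∀ f g, pairing (ι f) (ι' g) = pairing f g := fun f g => by
    rw [pairing_eq_integral, pairing_eq_integral, integral_map hφ.aemeasurable]
    · refine integral_congr_ae ?_
      filter_upwards [hι f, hι' g] with x h1 h2
      rw [h1, h2]
      rfl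
    · exact (Lp.aestronglyMeasurable f).mul (Lp.aestronglyMeasurable g)
  -- The analogue of conditional expectation: f − ι (R f) is orthogonal to all pullbacks.
  let R : Lp ℂ r μ →L[ℂ] Lp ℂ r (μ.map φ) := lpAdjoint (r' := r) (s' := r) hr' hr'top ι'
  have hR : ∀ f g, pairing (R f) g = pairing f (ι' g) := fun f g => by
    rw [pairing_comm, pairing_lpAdjoint, pairing_comm]
  obtain ⟨δ, hδ, hδh⟩ := hΦ.exists_eval
  let K : (Lp ℂ r μ →L[ℂ] ℂ) →L[ℂ] Lp ℂ r' (μ.map φ) :=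
    (dualEquiv (r' := r') hr hr_top).symm.toContinuousLinearMap.comp
      ((ContinuousLinearMap.compL ℂ (Lp ℂ r (μ.map φ)) (Lp ℂ r μ) ℂ).flip (S.comp ι))
  have hK : ∀ f x, pairing f (K (δ x)) = Φ (S (ι f)) x := fun f x => by
    rw [← hδ]
    simp [K]
  have hKh : IsBoundedHolder α fun x => K (δ x) := hδh.clm_comp K
  have hKm : AEStronglyMeasurable (fun x => K (δ x)) μ := by
    refine aestronglyMeasurable_of_pairing hr hr_top fun f => ?_
    simp_rw [hK]
    exact ((Lp.aestronglyMeasurable (S (S (ι f)))).congr (hΦ.ae_eq _).symm).aemeasurable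
  refine ⟨fun x => ι' (K (δ x)), hKh.clm_comp ι', ι'.continuous.comp_aestronglyMeasurable hKm,
    fun _ => ?_, fun f => ?_⟩
  · exact ι'.continuous.comp_stronglyMeasurable (hKh.continuous hα).stronglyMeasurable
  · have h1 : Φ (S (f - ι (R f))) =ᵐ[μ] 0 := hker _ fun g => by
      change pairing (f - ι (R f)) (ι' g) = 0
      rw [map_sub, sub_apply, hpair, hR, sub_self]
    filter_upwards [h1, hΦ.ae_eq (S f)] with x h1 h2
    rw [ContinuousLinearMap.comp_apply, ← h2, ← hR, hK]
    rw [map_sub, map_sub, Pi.sub_apply, Pi.zero_apply, sub_eq_zero] at h1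
    exact h1

end Kernel

/-! ### The Cauchy problem along orbits -/

section Orbit

variable {E : Type*} [NormedAddCommGroup E] [NormedSpace ℂ E] [NormedSpace ℝ E]
  [IsScalarTower ℝ ℂ E] {A : E →ₗ.[ℂ] E} {T : ℝ → E →L[ℂ] E}

/-- A function that is locally an orbit of the semigroup solves the Cauchy problem. -/
theorem cauchy_of_locally_orbit (hAT : IsGenerator A T) (hT : IsC0Semigroup T)
    (hd : IsDifferentiableSemigroup T) {u : ℝ → A.domain}
    (hu : ∀ t, 0 < t → ∃ s f, 0 ≤ s ∧ s < t ∧ ∀ t', s < t' → (u t' : E) = T (t' - s) f) :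
    ContDiffOn ℝ 1 (fun t => (u t : E)) (Set.Ioi 0) ∧
      ContinuousOn (fun t => ((u t : E), A (u t))) (Set.Ioi 0) ∧
      ∀ t, 0 < t → HasDerivAt (fun t => (u t : E)) (A (u t)) t := by
  have hderiv : ∀ t, 0 < t → HasDerivAt (fun t => (u t : E)) (A (u t)) t := by
    intro t ht
    obtain ⟨s, f, -, hst, hf⟩ := hu t ht
    have h1 : (T (t - s) f, A (u t)) ∈ A.graph := by
      rw [← hf t hst]
      exact A.mem_graph (u t)
    have h2 := (hAT.hasDerivAt_orbit hT hd (sub_pos.2 hst) h1).comp_sub_const t s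
    refine h2.congr_of_eventuallyEq ?_
    filter_upwards [Ioi_mem_nhds hst] with t' ht'
    exact hf t' ht'
  have hcont : ContinuousOn (fun t => A (u t)) (Set.Ioi 0) := by
    intro t ht
    obtain ⟨s, f, hs, hst, hf⟩ := hu t ht
    have h1 : ∀ t', 0 < t' → (T t' f, A (u (t' + s))) ∈ A.graph := fun t' ht' => by
      have := hf (t' + s) (by linarith)
      rw [add_sub_cancel_right] at this
      rw [← this]
      exact A.mem_graph _
    have h2 : ContinuousAt (fun t' => A (u (t' + s))) (t - s) :=
      (hAT.continuousOn_deriv_orbit hT hd h1).continuousAt (Ioi_mem_nhds (sub_pos.2 hst))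
    have h3 : ContinuousAt (fun t' => A (u (t' - s + s))) t :=
      ContinuousAt.comp (g := fun t' => A (u (t' + s))) (f := fun t' => t' - s) h2 (by fun_prop)
    simp_rw [sub_add_cancel] at h3
    exact h3.continuousWithinAt
  have hdiff : DifferentiableOn ℝ (fun t => (u t : E)) (Set.Ioi 0) := fun t ht =>
    (hderiv t ht).differentiableAt.differentiableWithinAt
  refine ⟨?_, hdiff.continuousOn.prodMk hcont, hderiv⟩
  rw [← zero_add (1 : WithTop ℕ∞), contDiffOn_succ_iff_deriv_of_isOpen isOpen_Ioi]
  refine ⟨hdiff, by simp, ?_⟩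
  rw [contDiffOn_zero]
  exact hcont.congr fun t ht => (hderiv t ht).deriv

end Orbit

/-! ### Compatibility of kernels at different times -/

section Kernel

variable {X : Type*} [MeasurableSpace X] {μ : Measure X} [SigmaFinite μ]
  {r r' : ℝ≥0∞} [Fact (1 ≤ r)] [Fact (1 ≤ r')] [ENNReal.HolderConjugate r r']

/-- The exceptional set in the hypothesis depends on f. Strong measurability confines F − G to a
separable set, where countably many functionals suffice; by Riesz each is a pairing. -/
theorem ae_eq_of_pairing (hr : 1 < r) (hr_top : r < ∞) {F G : X → Lp ℂ r' μ}
    (hF : AEStronglyMeasurable F μ) (hG : AEStronglyMeasurable G μ)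
    (h : ∀ f : Lp ℂ r μ, ∀ᵐ x ∂μ, pairing f (F x) = pairing f (G x)) : F =ᵐ[μ] G := by
  have : ENNReal.HolderConjugate r' r := ENNReal.HolderConjugate.symm
  have hr' : 1 < r' := (ENNReal.HolderConjugate.lt_top_iff_one_lt r r').1 hr_top
  have hr'top : r' < ∞ := (ENNReal.HolderConjugate.lt_top_iff_one_lt r' r).2 hr
  obtain ⟨t, ht, hFt⟩ := (hF.sub hG).isSeparable_ae_range
  have := ae_eq_zero_of_forall_dual_of_isSeparable ℂ ht (fun c => ?_) hFt
  · filter_upwards [this] with x hx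
    exact sub_eq_zero.1 hx
  · obtain ⟨f, hf⟩ := exists_pairing_eq (r' := r) hr' hr'top c
    filter_upwards [h f] with x hx
    rw [Pi.sub_apply, ← hf, pairing_comm, map_sub, hx, sub_self, Pi.zero_apply]

variable [EMetricSpace X]

theorem IsKernelOf.ae_eq_adjoint (hr : 1 < r) (hr_top : r < ∞) {α : ℝ≥0}
    {S₁ S₂ U : Lp ℂ r μ →L[ℂ] Lp ℂ r μ} {U' : Lp ℂ r' μ →L[ℂ] Lp ℂ r' μ}
    {κ₁ κ₂ : X → Lp ℂ r' μ} (h₁ : IsKernelOf α S₁ κ₁) (h₂ : IsKernelOf α S₂ κ₂)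
    (hU : ∀ f g, pairing (U f) g = pairing f (U' g)) (hS : S₁ = S₂.comp U) :
    ∀ᵐ x ∂μ, κ₁ x = U' (κ₂ x) := by
  refine ae_eq_of_pairing hr hr_top h₁.aestronglyMeasurable
    (U'.continuous.comp_aestronglyMeasurable h₂.aestronglyMeasurable) fun f => ?_
  filter_upwards [h₁.ae_eq f, h₂.ae_eq (U f)] with x h1 h2
  rw [← h1, ← hU, ← h2, hS, ContinuousLinearMap.comp_apply]

/-- The sequence of times at which kernels are chosen. -/
def kernelTime (n : ℕ) : ℝ := 1 / ((n : ℝ) + 1)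

theorem kernelTime_pos (n : ℕ) : 0 < kernelTime n := Nat.one_div_pos_of_nat

theorem kernelTime_strictAnti : StrictAnti kernelTime := fun _ _ h =>
  Nat.one_div_lt_one_div h

/-- Almost everywhere the kernels belong to one orbit of the adjoint semigroup. -/
theorem ae_forall_orbit_eq (hr : 1 < r) (hr_top : r < ∞) {α : ℝ≥0}
    {T : ℝ → Lp ℂ r μ →L[ℂ] Lp ℂ r μ} {T' : ℝ → Lp ℂ r' μ →L[ℂ] Lp ℂ r' μ}
    (hT : ∀ s t, 0 < s → 0 < t → T (s + t) = (T s).comp (T t))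
    (hT' : ∀ s t, 0 < s → 0 < t → T' (s + t) = (T' s).comp (T' t))
    (hadj : ∀ t f g, pairing (T t f) g = pairing f (T' t g))
    {κ : ℕ → X → Lp ℂ r' μ} (hκ : ∀ n, IsKernelOf α (T (kernelTime n)) (κ n)) :
    ∀ᵐ x ∂μ, ∀ n m t, kernelTime n < t → kernelTime m < t →
      T' (t - kernelTime n) (κ n x) = T' (t - kernelTime m) (κ m x) := by
  -- Only countably many pairs of times are compared here, so one null set suffices. The semigroup
  -- law then covers every real t.
  have h1 : ∀ᵐ x ∂μ, ∀ n m, n < m → κ n x = T' (kernelTime n - kernelTime m) (κ m x) := by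
    rw [ae_all_iff]
    intro n
    rw [ae_all_iff]
    intro m
    by_cases hnm : n < m
    · have h := sub_pos.2 (kernelTime_strictAnti hnm)
      filter_upwards [(hκ n).ae_eq_adjoint hr hr_top (hκ m) (hadj (kernelTime n - kernelTime m))
        (by rw [← hT _ _ (kernelTime_pos m) h, add_sub_cancel])] with x hx _
      exact hx
    · exact .of_forall fun x h => absurd h hnm
  filter_upwards [h1] with x hx
  have h2 : ∀ n m t, n < m → kernelTime n < t →
      T' (t - kernelTime n) (κ n x) = T' (t - kernelTime m) (κ m x) := fun n m t hnm ht => by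
    rw [hx n m hnm, ← ContinuousLinearMap.comp_apply, ← hT' _ _ (sub_pos.2 ht)
      (sub_pos.2 (kernelTime_strictAnti hnm)), sub_add_sub_cancel]
  intro n m t hn hm
  rcases lt_trichotomy n m with h | rfl | h
  · exact h2 n m t h hn
  · rfl
  · exact (h2 m n t h hm).symm

end Kernel

/-! ### Scalar kernels from pairs of vector-valued kernels -/

section SandwichedKernel

variable {X : Type*} [MeasurableSpace X] {μ : Measure X}
  {r r' : ℝ≥0∞} [Fact (1 ≤ r)] [Fact (1 ≤ r')] [ENNReal.HolderConjugate r r']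

/-- The function `(x, y) ↦ ⟨R κ'(y), κ(x)⟩`. -/
def sandwich (R : Lp ℂ r μ →L[ℂ] Lp ℂ r μ) (κ : X → Lp ℂ r' μ) (κ' : X → Lp ℂ r μ) (x y : X) : ℂ :=
  pairing (R (κ' y)) (κ x)

variable {α : ℝ≥0} {S : Lp ℂ r μ →L[ℂ] Lp ℂ r μ}
  {S' : Lp ℂ r' μ →L[ℂ] Lp ℂ r' μ} {κ : X → Lp ℂ r' μ} {κ' : X → Lp ℂ r μ}

/-- The increment splits by bilinearity into one term per variable, each controlled by a distance
below the sum metric. The two terms account for the factor 2. -/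
theorem isBoundedJointlyHolder_sandwich [EMetricSpace X] (hκ : IsBoundedHolder α κ) (hκ' : IsBoundedHolder α κ')
    (R : Lp ℂ r μ →L[ℂ] Lp ℂ r μ) : IsBoundedJointlyHolder α (sandwich R κ κ') := by
  obtain ⟨L, hL, hLh⟩ := hκ
  obtain ⟨L', hL', hLh'⟩ := hκ'.clm_comp R
  let P : Lp ℂ r μ →L[ℂ] Lp ℂ r' μ →L[ℂ] ℂ := pairing
  refine ⟨⟨‖P‖ * L' * L, fun x y => ?_⟩, ‖P‖₊ * L' * L * 2, fun x y x' y' => ?_⟩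
  · refine (P.le_opNorm₂ _ _).trans ?_
    gcongr
    · exact hL' y
    · exact hL x
  · have hle : ∀ f g, ‖P f g‖ₑ ≤ ‖P‖₊ * ‖f‖ₑ * ‖g‖ₑ := fun f g =>
      ((P f).le_opENorm g).trans (by gcongr; exact P.le_opENorm f)
    have h1 : ∀ x, ‖κ x‖ₑ ≤ L := fun x => by
      have := hL x
      simpa [enorm_eq_nnnorm, ← NNReal.coe_le_coe] using this
    have h2 : ∀ y, ‖R (κ' y)‖ₑ ≤ L' := fun y => by
      have := hL' y
      simpa [enorm_eq_nnnorm, ← NNReal.coe_le_coe] using this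
    have h3 : sandwich R κ κ' x y - sandwich R κ κ' x' y' =
        P (R (κ' y) - R (κ' y')) (κ x) + P (R (κ' y')) (κ x - κ x') := by
      simp [sandwich, P]
    have hα : ∀ a b : ℝ≥0∞, a ≤ b → a ^ (α : ℝ) ≤ b ^ (α : ℝ) := fun a b h =>
      ENNReal.rpow_le_rpow h α.2
    set e := (edist x x' + edist y y') ^ (α : ℝ)
    have hx : edist x x' ^ (α : ℝ) ≤ e := hα _ _ le_self_add
    have hy : edist y y' ^ (α : ℝ) ≤ e := hα _ _ le_add_self
    calc ‖sandwich R κ κ' x y - sandwich R κ κ' x' y'‖ₑ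
        ≤ ‖P‖₊ * (L' * e) * L + ‖P‖₊ * L' * (L * e) := by
          rw [h3]
          refine (enorm_add_le _ _).trans (add_le_add ?_ ?_)
          · refine (hle _ _).trans ?_
            gcongr
            · exact (hLh' y y').trans (by gcongr)
            · exact h1 x
          · refine (hle _ _).trans ?_
            gcongr
            · exact h2 y'
            · exact (hLh x x').trans (by gcongr)
      _ = ((‖P‖₊ * L' * L * 2 : ℝ≥0) : ℝ≥0∞) * e := by
          push_cast
          ring

theorem aestronglyMeasurable_sandwich [SigmaFinite μ] (hκ : AEStronglyMeasurable κ μ)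
    (hκ' : AEStronglyMeasurable κ' μ) (R : Lp ℂ r μ →L[ℂ] Lp ℂ r μ) :
    AEStronglyMeasurable (Function.uncurry (sandwich R κ κ')) (μ.prod μ) := by
  have h : Continuous fun z : Lp ℂ r' μ × Lp ℂ r μ => pairing (R z.2) z.1 := by fun_prop
  have h1 : AEStronglyMeasurable (fun z : X × X => κ z.1) (μ.prod μ) := hκ.comp_fst
  have h2 : AEStronglyMeasurable (fun z : X × X => κ' z.2) (μ.prod μ) := hκ'.comp_snd
  have h3 : AEStronglyMeasurable (fun z : X × X => (κ z.1, κ' z.2)) (μ.prod μ) := h1.prodMk h2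
  exact (h.comp_aestronglyMeasurable h3).congr (.of_forall fun _ => rfl)

theorem measurable_sandwich (hκ : StronglyMeasurable κ)
    (hκ' : StronglyMeasurable κ') (R : Lp ℂ r μ →L[ℂ] Lp ℂ r μ) :
    Measurable (Function.uncurry (sandwich R κ κ')) := by
  have h : Continuous fun z : Lp ℂ r' μ × Lp ℂ r μ => pairing (R z.2) z.1 := by fun_prop
  exact (h.comp_stronglyMeasurable ((hκ.comp_measurable measurable_fst).prodMk
    (hκ'.comp_measurable measurable_snd))).measurable

theorem sandwich_ae_eq_left [EMetricSpace X] (hκ : IsKernelOf α S κ) (R : Lp ℂ r μ →L[ℂ] Lp ℂ r μ) (y : X) :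
    (fun x => sandwich R κ κ' x y) =ᵐ[μ] S (R (κ' y)) :=
  (hκ.ae_eq _).symm

theorem sandwich_ae_eq_right [EMetricSpace X] [ENNReal.HolderConjugate r' r] (hκ' : IsKernelOf α S' κ') {R : Lp ℂ r μ →L[ℂ] Lp ℂ r μ}
    {R' : Lp ℂ r' μ →L[ℂ] Lp ℂ r' μ} (hR : ∀ f g, pairing (R f) g = pairing f (R' g)) (x : X) :
    (fun y => sandwich R κ κ' x y) =ᵐ[μ] S' (R' (κ x)) := by
  filter_upwards [hκ'.ae_eq (R' (κ x))] with y hy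
  rw [hy, sandwich, hR, pairing_comm]

end SandwichedKernel

/-! ### Uniqueness of integral kernels -/

section Uniqueness

variable {X : Type*} [MeasurableSpace X] {μ : Measure X}

/-- An integrable function on a product whose integrals over rectangles vanish is zero. -/
theorem ae_eq_zero_of_integral_prod_eq_zero {μ₁ μ₂ : Measure X} [IsFiniteMeasure μ₁]
    [IsFiniteMeasure μ₂] {q : X × X → ℂ} (hq : Integrable q (μ₁.prod μ₂))
    (h : ∀ E F, MeasurableSet E → MeasurableSet F → ∫ z in E ×ˢ F, q z ∂(μ₁.prod μ₂) = 0) :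
    q =ᵐ[μ₁.prod μ₂] 0 := by
  refine hq.ae_eq_zero_of_forall_setIntegral_eq_zero fun s hs _ => ?_
  have huniv : ∫ z, q z ∂(μ₁.prod μ₂) = 0 := by
    simpa using h Set.univ Set.univ .univ .univ
  induction s, hs using MeasurableSpace.induction_on_inter generateFrom_prod.symm
    isPiSystem_prod with
  | empty => simp
  | basic s hs =>
    obtain ⟨E, hE, F, hF, rfl⟩ := hs
    exact h E F hE hF
  | compl s hs ih =>
    have := integral_add_compl hs hq
    rwa [ih (measure_lt_top _ _), zero_add, huniv] at this
  | iUnion f hd hf ih =>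
    rw [integral_iUnion hf hd hq.integrableOn]
    simp [ih _ (measure_lt_top _ _)]

/-- For each set F of finite measure the integrals over F vanish for a.e. x. Fubini turns this into
vanishing integrals over rectangles, but only where q is jointly integrable, so the product is
exhausted by such pieces. -/
theorem ae_eq_zero_of_forall_integral_mul_eq_zero [SigmaFinite μ] {r : ℝ≥0∞} {q : X × X → ℂ}
    (hq : StronglyMeasurable q)
    (h : ∀ f : Lp ℂ r μ, ∀ᵐ x ∂μ, Integrable (fun y => q (x, y) * f y) μ ∧
      ∫ y, q (x, y) * f y ∂μ = 0) : q =ᵐ[μ.prod μ] 0 := by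
  have hset : ∀ F, MeasurableSet F → μ F ≠ ∞ →
      ∀ᵐ x ∂μ, IntegrableOn (fun y => q (x, y)) F μ ∧ ∫ y in F, q (x, y) ∂μ = 0 := by
    intro F hF hμF
    filter_upwards [h (indicatorConstLp r hF hμF 1)] with x hx
    have hae : (fun y => q (x, y) * indicatorConstLp r hF hμF (1 : ℂ) y) =ᵐ[μ]
        F.indicator fun y => q (x, y) := by
      filter_upwards [indicatorConstLp_coeFn (p := r) (hs := hF) (hμs := hμF) (c := (1 : ℂ))]
        with y hy
      rw [hy]
      by_cases hyF : y ∈ F <;> simp [hyF]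
    rw [integrable_congr hae, integral_congr_ae hae, integrable_indicator_iff hF,
      integral_indicator hF] at hx
    exact hx
  let S := spanningSets μ
  have hS : ∀ n, MeasurableSet (S n) := measurableSet_spanningSets μ
  have hSfin : ∀ n, μ (S n) < ∞ := measure_spanningSets_lt_top μ
  let ρ : ℕ → X → ℝ≥0∞ := fun n x => ∫⁻ y in S n, ‖q (x, y)‖ₑ ∂μ
  have hρ : ∀ n, Measurable (ρ n) := fun n => hq.enorm.lintegral_prod_right'
  -- On `Z (n, m)` the inner integral over `S n` is at most m, so q is integrable on `Z (n, m) ×ˢ S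
  -- n`. These sets cover almost all of the product since each ρ n is finite a.e.
  let Z : ℕ × ℕ → Set X := fun nm => S nm.1 ∩ {x | ρ nm.1 x ≤ nm.2}
  have hZ : ∀ nm, MeasurableSet (Z nm) := fun nm =>
    (hS nm.1).inter (measurableSet_le (hρ nm.1) measurable_const)
  have hpiece : ∀ nm : ℕ × ℕ, q =ᵐ[(μ.prod μ).restrict (Z nm ×ˢ S nm.1)] 0 := by
    intro nm
    have : Fact (μ (Z nm) < ∞) := ⟨(measure_mono Set.inter_subset_left).trans_lt (hSfin nm.1)⟩
    have : Fact (μ (S nm.1) < ∞) := ⟨hSfin nm.1⟩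
    rw [← Measure.prod_restrict]
    have hint : Integrable q ((μ.restrict (Z nm)).prod (μ.restrict (S nm.1))) := by
      refine ⟨hq.aestronglyMeasurable, ?_⟩
      rw [hasFiniteIntegral_iff_enorm, lintegral_prod _ hq.enorm.aemeasurable]
      calc ∫⁻ x in Z nm, ρ nm.1 x ∂μ ≤ ∫⁻ _ in Z nm, (nm.2 : ℝ≥0∞) ∂μ :=
            setLIntegral_mono measurable_const fun x hx => hx.2
        _ < ∞ := by
            rw [setLIntegral_const]
            exact ENNReal.mul_lt_top (ENNReal.natCast_lt_top _) Fact.out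
    refine ae_eq_zero_of_integral_prod_eq_zero hint fun E F hE hF => ?_
    rw [setIntegral_prod _ hint.integrableOn]
    refine integral_eq_zero_of_ae (ae_restrict_of_ae (ae_restrict_of_ae ?_))
    filter_upwards [hset (F ∩ S nm.1) (hF.inter (hS _))
      ((measure_mono Set.inter_subset_right).trans_lt (hSfin nm.1)).ne] with x hx
    rw [Measure.restrict_restrict hF]
    exact hx.2
  have hunion : q =ᵐ[(μ.prod μ).restrict (⋃ nm, Z nm ×ˢ S nm.1)] 0 := by
    rw [EventuallyEq, ae_restrict_iUnion_iff]
    exact hpiece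
  have hx : ∀ᵐ x ∂μ, ∀ n, ρ n x < ∞ := ae_all_iff.2 fun n => by
    filter_upwards [hset (S n) (hS n) (hSfin n).ne] with x hx
    exact hasFiniteIntegral_iff_enorm.1 hx.1.2
  rw [EventuallyEq, ae_restrict_iff' (.iUnion fun nm => (hZ nm).prod (hS nm.1))] at hunion
  filter_upwards [hunion, Measure.quasiMeasurePreserving_fst.ae hx] with z h1 h2
  refine h1 (Set.mem_iUnion.2 ?_)
  obtain ⟨a, ha⟩ := Set.mem_iUnion.1 ((iUnion_spanningSets μ).symm ▸ Set.mem_univ z.1)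
  obtain ⟨b, hb⟩ := Set.mem_iUnion.1 ((iUnion_spanningSets μ).symm ▸ Set.mem_univ z.2)
  obtain ⟨m, hm⟩ := ENNReal.exists_nat_gt (h2 (max a b)).ne
  exact ⟨(max a b, m), ⟨monotone_spanningSets μ (le_max_left a b) ha, hm.le⟩,
    monotone_spanningSets μ (le_max_right a b) hb⟩

/-- Two integral kernels of the same operator on `L^r` agree almost everywhere. -/
theorem kernel_unique [SigmaFinite μ] {r : ℝ≥0∞} {p₁ p₂ : X → X → ℂ}
    (h₁ : AEStronglyMeasurable (Function.uncurry p₁) (μ.prod μ))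
    (h₂ : AEStronglyMeasurable (Function.uncurry p₂) (μ.prod μ))
    (hi₁ : ∀ f : Lp ℂ r μ, ∀ᵐ x ∂μ, Integrable (fun y => p₁ x y * f y) μ)
    (hi₂ : ∀ f : Lp ℂ r μ, ∀ᵐ x ∂μ, Integrable (fun y => p₂ x y * f y) μ)
    (h : ∀ f : Lp ℂ r μ, (fun x => ∫ y, p₁ x y * f y ∂μ) =ᵐ[μ] fun x => ∫ y, p₂ x y * f y ∂μ) :
    Function.uncurry p₁ =ᵐ[μ.prod μ] Function.uncurry p₂ := by
  have hsub := h₁.sub h₂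
  have h0 : hsub.mk _ =ᵐ[μ.prod μ] 0 := by
    refine ae_eq_zero_of_forall_integral_mul_eq_zero (r := r) hsub.stronglyMeasurable_mk fun f => ?_
    filter_upwards [hi₁ f, hi₂ f, h f, Measure.ae_ae_of_ae_prod hsub.ae_eq_mk] with x h1 h2 h3 h4
    have hae : (fun y => hsub.mk _ (x, y) * f y) =ᵐ[μ]
        fun y => p₁ x y * f y - p₂ x y * f y := by
      filter_upwards [h4] with y hy
      rw [← hy, ← sub_mul]
      rfl
    rw [integrable_congr hae, integral_congr_ae hae, integral_sub h1 h2, sub_eq_zero]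
    exact ⟨h1.sub h2, h3⟩
  filter_upwards [hsub.ae_eq_mk, h0] with z h1 h2
  rw [← sub_eq_zero]
  exact h1.trans h2

end Uniqueness

/-! ### Replacing the operator in the second variable -/

section MixedAction

variable {X : Type*} [MeasurableSpace X] {μ : Measure X} {r : ℝ≥0∞} [Fact (1 ≤ r)]

theorem IsMixedAction.congr_right {s : ℝ≥0∞} [Fact (1 ≤ s)] {A : Lp ℂ r μ →ₗ.[ℂ] Lp ℂ r μ}
    {B : Lp ℂ r μ →ₗ.[ℂ] Lp ℂ r μ} {B' : Lp ℂ s μ →ₗ.[ℂ] Lp ℂ s μ} {q w : X → X → ℂ}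
    (h : IsMixedAction A B' q w) (hB : SameOperator B B') : IsMixedAction A B q w := by
  obtain ⟨v, hv, hw, h1, h2⟩ := h
  exact ⟨v, hv, hw, fun x => (hB _ _).2 (h1 x), h2⟩

end MixedAction

/-! ### The heat kernel and its properties -/

section Assembly

variable {X : Type*} [EMetricSpace X] [MeasurableSpace X] {μ : Measure X}
  {r r' : ℝ≥0∞} [Fact (1 ≤ r)] [Fact (1 ≤ r')] [ENNReal.HolderConjugate r r']
  [ENNReal.HolderConjugate r' r]

/-- Kernels of a semigroup and of its dual semigroup at the times `kernelTime n`. -/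
structure IsKernelFamily (α : ℝ≥0) (T : ℝ → Lp ℂ r μ →L[ℂ] Lp ℂ r μ)
    (T' : ℝ → Lp ℂ r' μ →L[ℂ] Lp ℂ r' μ) (κ : ℕ → X → Lp ℂ r' μ) (κ' : ℕ → X → Lp ℂ r μ) :
    Prop where
  map_add : ∀ s t, 0 < s → 0 < t → T (s + t) = (T s).comp (T t)
  map_add' : ∀ s t, 0 < s → 0 < t → T' (s + t) = (T' s).comp (T' t)
  adjoint : ∀ t f g, pairing (T t f) g = pairing f (T' t g)
  kernel : ∀ n, IsKernelOf α (T (kernelTime n)) (κ n)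
  kernel' : ∀ n, IsKernelOf α (T' (kernelTime n)) (κ' n)

/-- An index `n` with `2 * kernelTime n < t`. -/
def timeIndex (t : ℝ) : ℕ := ⌈2 / t⌉₊

theorem two_mul_kernelTime_lt {t : ℝ} (ht : 0 < t) : 2 * kernelTime (timeIndex t) < t := by
  have h1 : 2 / t < (timeIndex t : ℝ) + 1 := (Nat.le_ceil _).trans_lt (lt_add_one _)
  rw [kernelTime, mul_one_div, div_lt_iff₀ (by positivity), mul_comm]
  exact (div_lt_iff₀ ht).1 h1

theorem kernelTime_lt {t : ℝ} (ht : 0 < t) : kernelTime (timeIndex t) < t := by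
  linarith [two_mul_kernelTime_lt ht, kernelTime_pos (timeIndex t)]

/-- The heat kernel built from kernels at small times. -/
def heatKernel (T : ℝ → Lp ℂ r μ →L[ℂ] Lp ℂ r μ) (κ : ℕ → X → Lp ℂ r' μ) (κ' : ℕ → X → Lp ℂ r μ)
    (t : ℝ) : X → X → ℂ :=
  sandwich (T (t - 2 * kernelTime (timeIndex t))) (κ (timeIndex t)) (κ' (timeIndex t))

namespace IsKernelFamily

variable {α : ℝ≥0} {T : ℝ → Lp ℂ r μ →L[ℂ] Lp ℂ r μ} {T' : ℝ → Lp ℂ r' μ →L[ℂ] Lp ℂ r' μ}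
  {κ : ℕ → X → Lp ℂ r' μ} {κ' : ℕ → X → Lp ℂ r μ}

theorem comp_apply (h : IsKernelFamily α T T' κ κ') {s t u : ℝ} (hs : 0 < s) (ht : 0 < t)
    (hu : s + t = u) (f : Lp ℂ r μ) : T s (T t f) = T u f := by
  rw [← hu, h.map_add s t hs ht, ContinuousLinearMap.comp_apply]

theorem comp_apply' (h : IsKernelFamily α T T' κ κ') {s t u : ℝ} (hs : 0 < s) (ht : 0 < t)
    (hu : s + t = u) (g : Lp ℂ r' μ) : T' s (T' t g) = T' u g := by
  rw [← hu, h.map_add' s t hs ht, ContinuousLinearMap.comp_apply]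

theorem heatKernel_left (h : IsKernelFamily α T T' κ κ') {t : ℝ} (ht : 0 < t) (y : X) :
    (fun x => heatKernel T κ κ' t x y) =ᵐ[μ]
      T (t - kernelTime (timeIndex t)) (κ' (timeIndex t) y) := by
  rw [← h.comp_apply (kernelTime_pos _) (sub_pos.2 (two_mul_kernelTime_lt ht)) (by ring)]
  exact sandwich_ae_eq_left (h.kernel _) _ y

theorem heatKernel_right (h : IsKernelFamily α T T' κ κ') {t : ℝ} (ht : 0 < t) (x : X) :
    (fun y => heatKernel T κ κ' t x y) =ᵐ[μ]
      T' (t - kernelTime (timeIndex t)) (κ (timeIndex t) x) := by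
  rw [← h.comp_apply' (kernelTime_pos _) (sub_pos.2 (two_mul_kernelTime_lt ht)) (by ring)]
  exact sandwich_ae_eq_right (h.kernel' _) (h.adjoint _) x

theorem integral_eq (h : IsKernelFamily α T T' κ κ') {t : ℝ} (ht : 0 < t) (f : Lp ℂ r μ) :
    (∀ x, Integrable (fun y => heatKernel T κ κ' t x y * f y) μ) ∧
      T t f =ᵐ[μ] fun x => ∫ y, heatKernel T κ κ' t x y * f y ∂μ := by
  have hae : ∀ x, (fun y => heatKernel T κ κ' t x y * f y) =ᵐ[μ]
      fun y => f y * T' (t - kernelTime (timeIndex t)) (κ (timeIndex t) x) y := fun x => by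
    filter_upwards [h.heatKernel_right ht x] with y hy
    rw [hy, mul_comm]
  refine ⟨fun x => ?_, ?_⟩
  · rw [integrable_congr (hae x)]
    exact (Lp.memLp f).integrable_mul (Lp.memLp _)
  · have hpos := sub_pos.2 (kernelTime_lt ht)
    filter_upwards [(h.kernel (timeIndex t)).ae_eq (T (t - kernelTime (timeIndex t)) f)] with x hx
    rw [integral_congr_ae (hae x), ← pairing_eq_integral, ← h.adjoint, ← hx,
      h.comp_apply (u := t) (kernelTime_pos _) hpos (by ring)]

/-- For a.e. x and a.e. y the kernels at all chosen times lie on one orbit each. Transported to a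
common time τ, both sides equal ⟨κ'(y), T'(t + s − 2τ) κ(x)⟩. -/
theorem chapman_kolmogorov [SigmaFinite μ] (hr : 1 < r) (hr_top : r < ∞) (h : IsKernelFamily α T T' κ κ')
    {s t : ℝ} (hs : 0 < s) (ht : 0 < t) : ∀ᵐ z ∂(μ.prod μ),
      Integrable (fun w => heatKernel T κ κ' t z.1 w * heatKernel T κ κ' s w z.2) μ ∧
        heatKernel T κ κ' (t + s) z.1 z.2 =
          ∫ w, heatKernel T κ κ' t z.1 w * heatKernel T κ κ' s w z.2 ∂μ := by
  have hr' : 1 < r' := (ENNReal.HolderConjugate.lt_top_iff_one_lt r r').1 hr_top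
  have hr'top : r' < ∞ := (ENNReal.HolderConjugate.lt_top_iff_one_lt r' r).2 hr
  have hx := ae_forall_orbit_eq hr hr_top h.map_add h.map_add' h.adjoint h.kernel
  have hy := ae_forall_orbit_eq hr' hr'top h.map_add' h.map_add
    (fun t g f => by rw [pairing_comm, ← h.adjoint, pairing_comm]) h.kernel'
  filter_upwards [Measure.quasiMeasurePreserving_fst.ae hx,
    Measure.quasiMeasurePreserving_snd.ae hy] with z hx hy
  obtain ⟨x, y⟩ := z
  simp only at hx hy ⊢
  have hae : (fun w => heatKernel T κ κ' t x w * heatKernel T κ κ' s w y) =ᵐ[μ]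
      fun w => T (s - kernelTime (timeIndex s)) (κ' (timeIndex s) y) w *
        T' (t - kernelTime (timeIndex t)) (κ (timeIndex t) x) w := by
    filter_upwards [h.heatKernel_right ht x, h.heatKernel_left hs y] with w h1 h2
    rw [h1, h2, mul_comm]
  refine ⟨(integrable_congr hae).2 ((Lp.memLp _).integrable_mul (Lp.memLp _)), ?_⟩
  rw [integral_congr_ae hae, ← pairing_eq_integral]
  set n := timeIndex t
  set m := timeIndex s
  have hts : 0 < t + s := add_pos ht hs
  have hj2 := two_mul_kernelTime_lt hts
  rw [heatKernel]
  set j := timeIndex (t + s)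
  -- compare all kernels with those at one small time
  set k := max n (max m j)
  have hkn : kernelTime k ≤ kernelTime n := kernelTime_strictAnti.antitone (le_max_left _ _)
  have hkm : kernelTime k ≤ kernelTime m :=
    kernelTime_strictAnti.antitone ((le_max_left m j).trans (le_max_right _ _))
  have hkj : kernelTime k ≤ kernelTime j :=
    kernelTime_strictAnti.antitone ((le_max_right m j).trans (le_max_right _ _))
  have hn : kernelTime n < t := kernelTime_lt ht
  have hm : kernelTime m < s := kernelTime_lt hs
  have hk := kernelTime_pos k
  have hj := kernelTime_pos j
  rw [hy m k s hm (hkm.trans_lt hm), hx n k t hn (hkn.trans_lt hn), h.adjoint,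
    h.comp_apply' (u := t + s - kernelTime k - kernelTime k) (by linarith) (by linarith) (by ring),
    sandwich]
  have h1 : T (t + s - 2 * kernelTime j) (κ' j y) =
      T (t + s - kernelTime j - kernelTime k) (κ' k y) := by
    rw [← hy j k (t + s - kernelTime j) (by linarith) (by linarith)]
    congr 2
    ring
  have h2 : T' (t + s - kernelTime j - kernelTime k) (κ j x) =
      T' (t + s - kernelTime k - kernelTime k) (κ k x) := by
    rw [← hx j k (t + s - kernelTime k) (by linarith) (by linarith)]
    congr 2
    ring
  rw [h1, h.adjoint, h2]

theorem isHeatKernel [SigmaFinite μ] (hr : 1 < r) (hr_top : r < ∞) (h : IsKernelFamily α T T' κ κ')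
    {A : Lp ℂ r μ →ₗ.[ℂ] Lp ℂ r μ} (hT : IsC0Semigroup T) (hAT : IsGenerator A T)
    (hd : IsDifferentiableSemigroup T) : IsHeatKernel A T (heatKernel T κ κ') where
  measurable t _ := aestronglyMeasurable_sandwich (h.kernel _).aestronglyMeasurable
    (h.kernel' _).aestronglyMeasurable _
  integrable t ht f := .of_forall (h.integral_eq ht f).1
  memLp t ht f := (memLp_congr_ae (h.integral_eq ht f).2).1 (Lp.memLp _)
  semigroup_eq t ht f := (h.integral_eq ht f).2
  cauchy := by
    have hr' : 1 < r' := (ENNReal.HolderConjugate.lt_top_iff_one_lt r r').1 hr_top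
    have hr'top : r' < ∞ := (ENNReal.HolderConjugate.lt_top_iff_one_lt r' r).2 hr
    filter_upwards [ae_forall_orbit_eq hr' hr'top h.map_add' h.map_add
      (fun t g f => by rw [pairing_comm, ← h.adjoint, pairing_comm]) h.kernel'] with y hy
    have hmem : ∀ t (_ : 0 < t),
        T (t - kernelTime (timeIndex t)) (κ' (timeIndex t) y) ∈ A.domain := fun t ht => by
      obtain ⟨g, hg, -⟩ := hd.exists_graph hAT hT (sub_pos.2 (kernelTime_lt ht))
        (κ' (timeIndex t) y)
      exact LinearPMap.mem_domain_iff.2 ⟨g, hg⟩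
    -- The value 0 at t ≤ 0 is a mere default.
    let u : ℝ → A.domain := fun t => if ht : 0 < t then ⟨_, hmem t ht⟩ else 0
    have hu : ∀ t, 0 < t →
        (u t : Lp ℂ r μ) = T (t - kernelTime (timeIndex t)) (κ' (timeIndex t) y) :=
      fun t ht => by simp [u, ht]
    refine ⟨u, fun t ht => ?_, cauchy_of_locally_orbit hAT hT hd fun t ht => ?_⟩
    · rw [hu t ht]
      exact h.heatKernel_left ht y
    -- The index is frozen at `timeIndex t`. Although `timeIndex t'` jumps as t' varies, the
    -- compatibility `hy` identifies u with this single orbit at all t' beyond its starting time.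
    · refine ⟨kernelTime (timeIndex t), κ' (timeIndex t) y, (kernelTime_pos _).le,
        kernelTime_lt ht, fun t' ht' => ?_⟩
      have ht'0 := (kernelTime_pos _).trans ht'
      rw [hu t' ht'0]
      exact hy _ _ _ (kernelTime_lt ht'0) ht'
  chapman_kolmogorov s t hs ht := h.chapman_kolmogorov hr hr_top hs ht

/-- The kernel `A_x A'_y p_t` is jointly Hölder continuous. -/
theorem exists_isMixedAction [SigmaFinite μ] (hr : 1 < r) (h : IsKernelFamily α T T' κ κ')
    {A : Lp ℂ r μ →ₗ.[ℂ] Lp ℂ r μ} (hA : IsSmoothing A T)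
    (hA_dense : Dense (A.domain : Set (Lp ℂ r μ))) (hr_top : r < ∞) {t : ℝ} (ht : 0 < t) :
    ∃ w : X → X → ℂ, IsMixedAction A (dualOp r' A) (heatKernel T κ κ' t) w ∧
      IsBoundedJointlyHolder α w := by
  set n := timeIndex t with hn
  set σ := t - 2 * kernelTime n with hσ
  have hσ0 : 0 < σ := sub_pos.2 (two_mul_kernelTime_lt ht)
  obtain ⟨B, hB⟩ := hA.smoothing (σ / 2) (half_pos hσ0)
  have hT2 : ∀ f, T σ f = T (σ / 2) (T (σ / 2) f) := fun f =>
    (h.comp_apply (half_pos hσ0) (half_pos hσ0) (add_halves σ) f).symm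
  have hcomm : ∀ f, B (T (σ / 2) f) = T (σ / 2) (B f) := fun f =>
    graph_unique (hB _) (hA.map_graph _ (half_pos hσ0) _ _ (hB f))
  -- Since T(σ) = T(σ/2)², the two applications of A can each use one half: A T(σ) = B T(σ/2) gives
  -- the intermediate kernel v, and A T(σ/2) A T(σ/2) = B² gives w.
  refine ⟨sandwich (B.comp B) (κ n) (κ' n), ⟨sandwich (B.comp (T (σ / 2))) (κ n) (κ' n), ?_, ?_,
    fun x => ?_, fun y => ?_⟩, ?_⟩
  · exact aestronglyMeasurable_sandwich (h.kernel _).aestronglyMeasurable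
      (h.kernel' _).aestronglyMeasurable _
  · exact aestronglyMeasurable_sandwich (h.kernel _).aestronglyMeasurable
      (h.kernel' _).aestronglyMeasurable _
  · let R' := lpAdjoint (r' := r') (s' := r') hr hr_top (B.comp (T (σ / 2)))
    refine ⟨T' (kernelTime n) (T' σ (κ n x)), T' (kernelTime n) (R' (κ n x)), ?_,
      sandwich_ae_eq_right (h.kernel' n) (h.adjoint σ) x,
      sandwich_ae_eq_right (h.kernel' n) (fun f g => (pairing_lpAdjoint hr hr_top _ f g).symm) x⟩
    rw [dualOp_graph hr A hA_dense, mem_dualGraph_iff]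
    intro f g hfg
    have h1 := hA.map_graph _ (kernelTime_pos n) _ _ hfg
    have h2 := hA.map_graph _ hσ0 _ _ h1
    rw [hT2] at h2
    rw [← h.adjoint, ← h.adjoint, ← h.adjoint, pairing_lpAdjoint, graph_unique h2 (hB _)]
    rfl
  · refine ⟨T (kernelTime n) (B (T (σ / 2) (κ' n y))), T (kernelTime n) (B (B (κ' n y))), ?_,
      sandwich_ae_eq_left (h.kernel n) _ y, sandwich_ae_eq_left (h.kernel n) _ y⟩
    refine hA.map_graph _ (kernelTime_pos n) _ _ ?_
    rw [hcomm]
    exact hB _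
  · exact isBoundedJointlyHolder_sandwich (h.kernel _).holder (h.kernel' _).holder _

end IsKernelFamily

/-- Each time is halved because `exists_isKernelOf` produces a kernel of a square. Its hypotheses
are symmetric in A and A', so exchanging r and r' gives κ'. -/
theorem exists_isKernelFamily [SigmaFinite μ] (hr : 1 < r) (hr_top : r < ∞) {α : ℝ≥0} (hα : 0 < α)
    {A : Lp ℂ r μ →ₗ.[ℂ] Lp ℂ r μ} {T : ℝ → Lp ℂ r μ →L[ℂ] Lp ℂ r μ} (hA : IsSmoothing A T)
    (hA_dense : Dense (A.domain : Set (Lp ℂ r μ))) {k l : ℕ}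
    (hk : EmbedsInHolder (opPow A k) α) (hl : EmbedsInHolder (opPow (dualOp r' A) l) α) :
    ∃ (T' : ℝ → Lp ℂ r' μ →L[ℂ] Lp ℂ r' μ) (κ : ℕ → X → Lp ℂ r' μ) (κ' : ℕ → X → Lp ℂ r μ),
      IsKernelFamily α T T' κ κ' := by
  have hr' : 1 < r' := (ENNReal.HolderConjugate.lt_top_iff_one_lt r r').1 hr_top
  have hr'top : r' < ∞ := (ENNReal.HolderConjugate.lt_top_iff_one_lt r' r).2 hr
  have hA' := hA.dual (r' := r') hr hr_top hA_dense
  set T' : ℝ → Lp ℂ r' μ →L[ℂ] Lp ℂ r' μ := fun t => lpAdjoint (r' := r') (s' := r') hr hr_top (T t)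
  have hadj : ∀ t f g, pairing (T t f) g = pairing f (T' t g) := fun t f g =>
    (pairing_lpAdjoint hr hr_top _ f g).symm
  have hadj' : ∀ t g f, pairing (T' t g) f = pairing g (T t f) := fun t g f => by
    rw [pairing_comm, ← hadj, pairing_comm]
  have hrep : ∀ n, (∃ κ : X → Lp ℂ r' μ, IsKernelOf α (T (kernelTime n)) κ) ∧
      ∃ κ' : X → Lp ℂ r μ, IsKernelOf α (T' (kernelTime n)) κ' := by
    intro n
    have hpos := half_pos (kernelTime_pos n)
    obtain ⟨R, hR⟩ := hA.smoothing_pow k _ hpos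
    obtain ⟨R', hR'⟩ := hA'.smoothing_pow l _ hpos
    obtain ⟨Φ, C, hΦ⟩ := hk.exists_isHolderRep hR
    obtain ⟨Φ', C', hΦ'⟩ := hl.exists_isHolderRep hR'
    rw [← add_halves (kernelTime n), hA.map_add _ _ hpos hpos, hA'.map_add _ _ hpos hpos]
    exact ⟨exists_isKernelOf hr hr_top hα (hadj _) hΦ hΦ',
      exists_isKernelOf hr' hr'top hα (hadj' _) hΦ' hΦ⟩
  choose κ hκ using fun n => (hrep n).1
  choose κ' hκ' using fun n => (hrep n).2
  exact ⟨T', κ, κ', hA.map_add, hA'.map_add, hadj, hκ, hκ'⟩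

end Assembly

end HeatKernel

end

theorem mainTheorem1 {X : Type*} [EMetricSpace X] [MeasurableSpace X]
    (μ : Measure X) [SigmaFinite μ]
    (r r' : ℝ≥0∞) [Fact (1 ≤ r)] [Fact (1 ≤ r')] [ENNReal.HolderConjugate r r']
    (hr : 1 < r) (hr_top : r < ∞)
    (A : Lp ℂ r μ →ₗ.[ℂ] Lp ℂ r μ) (hA_closed : A.IsClosed)
    (hA_dense : Dense (A.domain : Set (Lp ℂ r μ)))
    (T : ℝ → Lp ℂ r μ →L[ℂ] Lp ℂ r μ) (hT : HeatKernel.IsC0Semigroup T)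
    (hAT : HeatKernel.IsGenerator A T) (hT_diff : HeatKernel.IsDifferentiableSemigroup T)
    (k l : ℕ) (α : ℝ≥0) (hα : 0 < α) (hα' : α ≤ 1)
    (hk : HeatKernel.EmbedsInHolder (HeatKernel.opPow A k) α)
    (hl : HeatKernel.EmbedsInHolder (HeatKernel.opPow (HeatKernel.dualOp r' A) l) α) :
    ∃ p : ℝ → X → X → ℂ,
      HeatKernel.IsHeatKernel A T p ∧
      -- up to null sets, `p` is the only heat kernel
      (∀ p' : ℝ → X → X → ℂ, HeatKernel.IsHeatKernel A T p' →
        ∀ t, 0 < t → Function.uncurry (p' t) =ᵐ[μ.prod μ] Function.uncurry (p t)) ∧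
      -- if the open sets are measurable, `p t` is measurable without completing the measure
      (OpensMeasurableSpace X → ∀ t, 0 < t → Measurable (Function.uncurry (p t))) ∧
      -- (i)
      (∀ t, 0 < t → HeatKernel.IsBoundedJointlyHolder α (p t)) ∧
      -- (ii), where `A = A'` for the bilinear dual pairing
      (r = 2 → HeatKernel.SameOperator A (HeatKernel.dualOp r' A) →
        ∀ t, 0 < t → ∃ w : X → X → ℂ,
          HeatKernel.IsMixedAction A A (p t) w ∧ HeatKernel.IsBoundedJointlyHolder α w) ∧
      -- (ii), where `A` is self-adjoint in the Hilbert space sense; the operator that acts on the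
      -- second variable is then `A'`, the complex conjugate of `A`
      (r = 2 → ∀ B : Lp ℂ 2 μ →ₗ.[ℂ] Lp ℂ 2 μ, IsSelfAdjoint B → HeatKernel.SameOperator A B →
        ∀ t, 0 < t → ∃ w : X → X → ℂ,
          HeatKernel.IsMixedAction A (HeatKernel.dualOp r' A) (p t) w ∧
            HeatKernel.IsBoundedJointlyHolder α w) := by
  have : ENNReal.HolderConjugate r' r := ENNReal.HolderConjugate.symm
  have hA := hAT.isSmoothing hT hT_diff hA_closed
  obtain ⟨T', κ, κ', h⟩ := HeatKernel.exists_isKernelFamily hr hr_top hα hA hA_dense hk hl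
  have hp := h.isHeatKernel hr hr_top hT hAT hT_diff
  refine ⟨HeatKernel.heatKernel T κ κ', hp, fun p' hp' t ht => ?_, fun _ t _ => ?_,
    fun t _ => ?_, fun _ hAA' t ht => ?_, fun _ _ _ _ t ht => ?_⟩
  · exact HeatKernel.kernel_unique (r := r) (hp'.measurable t ht) (hp.measurable t ht)
      (hp'.integrable t ht) (hp.integrable t ht)
      fun f => (hp'.semigroup_eq t ht f).symm.trans (hp.semigroup_eq t ht f)
  · exact HeatKernel.measurable_sandwich ((h.kernel _).stronglyMeasurable inferInstance)
      ((h.kernel' _).stronglyMeasurable inferInstance) _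
  · exact HeatKernel.isBoundedJointlyHolder_sandwich (h.kernel _).holder (h.kernel' _).holder _
  -- The Hölder function A_x A'_y p_t exists in general; the equality A = A' turns it into A_x A_y
  -- p_t.
  · obtain ⟨w, hw, hw'⟩ := h.exists_isMixedAction hr hA hA_dense hr_top ht
    exact ⟨w, hw.congr_right hAA', hw'⟩
  · exact h.exists_isMixedAction hr hA hA_dense hr_top ht
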